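/- Let $n,d$ be integers, $T\in(0,\infty)$, $\mathbb T^d=(\mathbb R/2\pi\mathbb Z)^d$ and $Q_T=\mathbb T^d\times[0,T)$. Let $A,F_\alpha:\mathbb R^n\to\mathbb R^n$ and $\eta,q_\alpha:\mathbb R^n\to\mathbb R$ $(\alpha=1,\dots,d)$ be of class $C^2$ and $G:\mathbb R^n\to\mathbb R^n$ of class $C^1$, such that: * (H1) $A$ is one-to-one and $\nabla A(u)$ is nonsingular for every $u\in\mathbb R^n$; * (H2) $\nabla\eta=G\cdot\nabla A$ and $\nabla q_\alpha=G\cdot\nabla F_\alpha$ for $\alpha=1,\dots,d$; * (H3) $\xi\cdot\big(\nabla^2\eta(u)-\sum_k G_k(u)\nabla^2A_k(u)\big)\xi>0$ for all $u\in\mathbb R^n$, $\xi\in\mathbb R^n\setminus\{0\}$; * (A1) for some $p\in(1,\infty)$ and $\beta_1,\beta_2,B>0$: $\beta_1(|u|^p+1)-B\le\eta(u)\le\beta_2(|u|^p+1)$ for all $u$; * (A2) $|F_\alpha(u)|/\eta(u)\to0$ as $|u|\to\infty$, $\alpha=1,\dots,d$; * (A3) $|A(u)|/\eta(u)\to0$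 as $|u|\to\infty$; * (A4) for some $r>1$ and $C,B'>0$: $\frac1C(|A(u)|^r+1)-B'\le\eta(u)\le C(|A(u)|^r+1)$ for all $u$; * $\eta\ge0$. Let $(u,\boldsymbol\nu,\boldsymbol\gamma)$ be a dissipative measure-valued solution with concentration of $\partial_tA(u)+\sum_\alpha\partial_\alpha F_\alpha(u)=0$ on $Q_T$, with initial Young measure $\boldsymbol\nu_0=(\boldsymbol\nu_{0,x})_{x\in\mathbb T^d}$ and initial concentration measure $\boldsymbol\gamma_0$. That is: $u\in L^\infty(0,T;L^p(\mathbb T^d))$; $\boldsymbol\nu=(\boldsymbol\nu_{x,t})$ and $\boldsymbol\nu_0$ are weak-$*$ measurable families of probability measures on $\mathbb R^n$ for which $\langle\boldsymbol\nu_{x,t},\eta\rangle$ and $\langle\boldsymbol\nu_{0,x},\eta\rangle$ are integrable over $Q_T$ and $\mathbb T^d$ respectively; $\boldsymbol\gamma$ and $\boldsymbol\gamma_0$ are non-negative Radon measures on $Q_T$ and $\mathbb T^d$; $u(x,t)=\langle\boldsymbol\nu_{x,t},\lambda\rangle$ for a.e. $(x,t)\in Q_T$; for $i=1,\dots,n$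 and every scalar $\varphi\in C^1_c(\mathbb T^d\times[0,T))$, $$\iint_{Q_T}\langle\boldsymbol\nu_{x,t},A_i\rangle\,\partial_t\varphi\,dx\,dt+\iint_{Q_T}\sum_{\alpha}\langle\boldsymbol\nu_{x,t},F_{i,\alpha}\rangle\,\partial_\alpha\varphi\,dx\,dt+\int_{\mathbb T^d}\langle\boldsymbol\nu_{0,x},A_i\rangle\,\varphi(x,0)\,dx=0;$$ and for every $\xi\in C^1_c([0,T))$ with $\xi\ge0$, $$\iint_{Q_T}\frac{d\xi}{dt}\big[\langle\boldsymbol\nu_{x,t},\eta\rangle\,dx\,dt+\boldsymbol\gamma(dx\,dt)\big]+\int_{\mathbb T^d}\xi(0)\big[\langle\boldsymbol\nu_{0,x},\eta\rangle\,dx+\boldsymbol\gamma_0(dx)\big]\ge0.$$ Let $\bar u\in W^{1,\infty}(\mathbb T^d\times[0,T];\mathbb R^n)$ (taken as its continuous representative) be a strong solution, i.e. $\partial_tA(\bar u)+\sum_\alpha\partial_\alpha F_\alpha(\bar u)=0$ a.e. on $Q_T$, and put $\bar u_0=\bar u(\cdot,0)$. If $\boldsymbol\gamma_0=0$ and $\boldsymbol\nu_{0,x}=\delta_{\bar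 u_0(x)}$ for a.e. $x\in\mathbb T^d$, then $\boldsymbol\nu_{x,t}=\delta_{\bar u(x,t)}$ and $u(x,t)=\bar u(x,t)$ for a.e. $(x,t)\in Q_T$. -/

import Mathlib

open MeasureTheory ProbabilityTheory Filter Topology Asymptotics
open scoped ContDiff NNReal

namespace ConsLaw

/-- The state space `ℝⁿ` with the Euclidean norm. -/
abbrev State (n : ℕ) : Type := EuclideanSpace ℝ (Fin n)

instance factTwoPi : Fact (0 < 2 * Real.pi) := ⟨Real.two_pi_pos⟩

/-- The torus `𝕋ᵈ = (ℝ / 2πℤ)ᵈ`. Its `volume` is Lebesgue measure, of total mass `(2π)ᵈ`. -/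
abbrev Torus (d : ℕ) : Type := Fin d → AddCircle (2 * Real.pi)

/-- The space-time cylinder `Q_T = 𝕋ᵈ × [0,T)`. -/
def cyl (d : ℕ) (T : ℝ) : Set (Torus d × ℝ) := Set.univ ×ˢ Set.Ico 0 T

/-- Lebesgue measure `dx dt` on `Q_T`. -/
noncomputable def cylVol (d : ℕ) (T : ℝ) : Measure (Torus d × ℝ) :=
  (volume : Measure (Torus d × ℝ)).restrict (cyl d T)

/-! ### Structural hypotheses on the constitutive functions -/

/-- (H₁): `A` is a `C²` one-to-one map and `∇A(u)` is nonsingular for every `u`. -/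
structure HypH1 {n : ℕ} (A : State n → State n) : Prop where
  contDiff : ContDiff ℝ 2 A
  injective : Function.Injective A
  nonsingular : ∀ u, (fderiv ℝ A u).IsInvertible

/-- (H₂): `(η, q)` is an entropy pair with multiplier `G`, that is
`∇η = G · ∇A` and `∇q_α = G · ∇F_α` for all `α`. -/
structure HypH2 {n d : ℕ} (A : State n → State n) (F : Fin d → State n → State n)
    (η : State n → ℝ) (q : Fin d → State n → ℝ) (G : State n → State n) : Prop where
  contDiff_eta : ContDiff ℝ 2 η
  contDiff_q : ∀ α, ContDiff ℝ 2 (q α)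
  contDiff_G : ContDiff ℝ 1 G
  grad_eta : ∀ u v, fderiv ℝ η u v = inner ℝ (G u) (fderiv ℝ A u v)
  grad_q : ∀ α u v, fderiv ℝ (q α) u v = inner ℝ (G u) (fderiv ℝ (F α) u v)

/-- (H₃): `ξ · (∇²η(u) - G(u) · ∇²A(u)) ξ > 0` for `ξ ≠ 0`. -/
def HypH3 {n : ℕ} (A : State n → State n) (η : State n → ℝ) (G : State n → State n) : Prop :=
  ∀ u ξ : State n, ξ ≠ 0 →
    0 < fderiv ℝ (fderiv ℝ η) u ξ ξ - inner ℝ (G u) (fderiv ℝ (fderiv ℝ A) u ξ ξ)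

/-! ### Growth hypotheses -/

/-- (A₁): `β₁ (|u|ᵖ + 1) - B ≤ η(u) ≤ β₂ (|u|ᵖ + 1)`. -/
def HypA1 {n : ℕ} (η : State n → ℝ) (p : ℝ) : Prop :=
  ∃ β₁ β₂ B : ℝ, 0 < β₁ ∧ 0 < β₂ ∧ 0 < B ∧
    ∀ u, β₁ * (‖u‖ ^ p + 1) - B ≤ η u ∧ η u ≤ β₂ * (‖u‖ ^ p + 1)

/-- (A₂): `|F_α(u)| / η(u) → 0` as `|u| → ∞`, for every `α`. -/
def HypA2 {n d : ℕ} (F : Fin d → State n → State n) (η : State n → ℝ) : Prop :=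
  ∀ α, Tendsto (fun u => ‖F α u‖ / η u) (cocompact (State n)) (𝓝 0)

/-- (A₃): `|A(u)| / η(u) → 0` as `|u| → ∞`. -/
def HypA3 {n : ℕ} (A : State n → State n) (η : State n → ℝ) : Prop :=
  Tendsto (fun u => ‖A u‖ / η u) (cocompact (State n)) (𝓝 0)

/-- (A₄): `(1/C) (|A(u)|^r + 1) - B ≤ H(A(u)) ≤ C (|A(u)|^r + 1)` for some `r > 1`, where
`H = η ∘ A⁻¹`, so that `H(A(u)) = η(u)`. -/
def HypA4 {n : ℕ} (A : State n → State n) (η : State n → ℝ) : Prop :=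
  ∃ r C B : ℝ, 1 < r ∧ 0 < C ∧ 0 < B ∧
    ∀ u, 1 / C * (‖A u‖ ^ r + 1) - B ≤ η u ∧ η u ≤ C * (‖A u‖ ^ r + 1)

/-! ### Test functions and derivatives on `𝕋ᵈ × ℝ` -/

/-- The `2π`-periodic lift to `ℝᵈ × ℝ` of a function on `𝕋ᵈ × ℝ`. -/
noncomputable def lift {d : ℕ} (φ : Torus d × ℝ → ℝ) : (Fin d → ℝ) × ℝ → ℝ :=
  fun y => φ (fun i => (y.1 i : AddCircle (2 * Real.pi)), y.2)

/-- The time derivative `∂_t φ`. -/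
noncomputable def dt {d : ℕ} (φ : Torus d × ℝ → ℝ) (z : Torus d × ℝ) : ℝ :=
  deriv (fun s : ℝ => φ (z.1, s)) z.2

/-- The space derivative `∂_α φ`. -/
noncomputable def dx {d : ℕ} (α : Fin d) (φ : Torus d × ℝ → ℝ) (z : Torus d × ℝ) : ℝ :=
  deriv (fun s : ℝ => φ (z.1 + Pi.single α (s : AddCircle (2 * Real.pi)), z.2)) 0

/-- `φ ∈ C¹_c(𝕋ᵈ × [0,T))`: the function `φ` need not vanish at `t = 0`. (A `C¹` function on
`𝕋ᵈ × [0,T)` is represented by a `C¹` extension to negative times; only the values at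
`0 ≤ t < T` are ever used.) -/
def IsTest {d : ℕ} (T : ℝ) (φ : Torus d × ℝ → ℝ) : Prop :=
  ContDiff ℝ 1 (lift φ) ∧ ∃ τ < T, ∀ x t, τ ≤ t → φ (x, t) = 0

/-- `φ ∈ C^∞_c(𝕋ᵈ × (0,T))`. -/
def IsInteriorTest {d : ℕ} (T : ℝ) (φ : Torus d × ℝ → ℝ) : Prop :=
  ContDiff ℝ ∞ (lift φ) ∧ ∃ σ τ : ℝ, 0 < σ ∧ τ < T ∧ ∀ x t, (t ≤ σ ∨ τ ≤ t) → φ (x, t) = 0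

/-- `ξ ∈ C¹_c([0,T))` with `ξ ≥ 0` on `[0,T)`; here too `ξ` stands for a `C¹` extension. -/
def IsTimeTest (T : ℝ) (ξ : ℝ → ℝ) : Prop :=
  ContDiff ℝ 1 ξ ∧ (∃ τ < T, ∀ t, τ ≤ t → ξ t = 0) ∧ ∀ t ∈ Set.Ico 0 T, 0 ≤ ξ t

/-! ### `W^{1,∞}` and strong solutions -/

/-- `g ∈ L^∞(Q_T)` is the weak time derivative of `f` on `Q_T`. -/
def HasWeakDt {n d : ℕ} (T : ℝ) (f g : Torus d × ℝ → State n) : Prop :=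
  MemLp g ⊤ (cylVol d T) ∧ ∀ φ, IsInteriorTest T φ →
    ∫ z, dt φ z • f z ∂(cylVol d T) = -∫ z, φ z • g z ∂(cylVol d T)

/-- `g ∈ L^∞(Q_T)` is the weak derivative of `f` in the direction `x_α` on `Q_T`. -/
def HasWeakDx {n d : ℕ} (T : ℝ) (α : Fin d) (f g : Torus d × ℝ → State n) : Prop :=
  MemLp g ⊤ (cylVol d T) ∧ ∀ φ, IsInteriorTest T φ →
    ∫ z, dx α φ z • f z ∂(cylVol d T) = -∫ z, φ z • g z ∂(cylVol d T)

/-- `f ∈ W^{1,∞}(𝕋ᵈ × [0,T])`, with `f` the continuous representative of its class; thus `f` is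
bounded, and its value at `t = 0` makes sense. -/
structure MemW1Inf {n d : ℕ} (T : ℝ) (f : Torus d × ℝ → State n) : Prop where
  continuousOn : ContinuousOn f (Set.univ ×ˢ Set.Icc 0 T)
  weakDt : ∃ g, HasWeakDt T f g
  weakDx : ∀ α, ∃ g, HasWeakDx T α f g

/-- `ū` solves `∂_t A(ū) + ∑_α ∂_α F_α(ū) = 0` almost everywhere on `Q_T`, the derivatives
being weak derivatives that are bounded functions. -/
def IsStrongSolution {n d : ℕ} (T : ℝ) (A : State n → State n) (F : Fin d → State n → State n)
    (ubar : Torus d × ℝ → State n) : Prop :=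
  ∃ (a : Torus d × ℝ → State n) (f : Fin d → Torus d × ℝ → State n),
    HasWeakDt T (fun z => A (ubar z)) a ∧
    (∀ α, HasWeakDx T α (fun z => F α (ubar z)) (f α)) ∧
    ∀ᵐ z ∂(cylVol d T), a z + ∑ α, f α z = 0

/-! ### Dissipative measure-valued solutions -/

/-- `(u, ν, γ)` is a dissipative measure-valued solution with concentration on `Q_T`, with
initial Young measure `ν₀` and initial concentration measure `γ₀`.

Young measures are Markov kernels (weak-∗ measurable families of probability measures).
The measure `γ` lives on `Q_T` (only its restriction to `Q_T` is used) and is Radon there.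
The fields `integrable_eta` and `integrable_eta_zero` say that `⟨ν, |η|⟩` and `⟨ν₀, |η|⟩` are
integrable over `Q_T` and over `𝕋ᵈ`; when `A` and `F_α` are continuous and `o(η)` at infinity and
`η` grows like `|u|ᵖ`, all the other averages below are then finite and integrable as well. -/
structure IsDissipativeMVSolution {n d : ℕ} (T p : ℝ) (A : State n → State n)
    (F : Fin d → State n → State n) (η : State n → ℝ)
    (u : Torus d × ℝ → State n) (ν : Kernel (Torus d × ℝ) (State n))
    (γ : Measure (Torus d × ℝ)) (ν₀ : Kernel (Torus d) (State n))
    (γ₀ : Measure (Torus d)) : Prop where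
  markov : IsMarkovKernel ν
  markov_zero : IsMarkovKernel ν₀
  radon : ∀ τ < T, γ (Set.univ ×ˢ Set.Icc 0 τ) < ⊤
  finite_zero : IsFiniteMeasure γ₀
  /-- `u ∈ L^∞(0,T; Lᵖ(𝕋ᵈ))`. -/
  aestronglyMeasurable : AEStronglyMeasurable u (cylVol d T)
  bounded_Lp : ∃ M : ℝ≥0, ∀ᵐ t ∂(volume.restrict (Set.Ico 0 T)),
    eLpNorm (fun x => u (x, t)) (ENNReal.ofReal p) volume ≤ M
  integrable_eta : Integrable (fun w => η w.2) ((cylVol d T).compProd ν)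
  integrable_eta_zero : Integrable (fun w => η w.2) ((volume : Measure (Torus d)).compProd ν₀)
  /-- `u(x,t) = ⟨ν_{x,t}, λ⟩`. -/
  barycenter : ∀ᵐ z ∂(cylVol d T), u z = ∫ l, l ∂(ν z)
  /-- The averaged conservation laws. -/
  weak_form : ∀ (i : Fin n) (φ : Torus d × ℝ → ℝ), IsTest T φ →
    ∫ z, (∫ l, A l i ∂(ν z)) * dt φ z ∂(cylVol d T)
      + ∫ z, ∑ α, (∫ l, F α l i ∂(ν z)) * dx α φ z ∂(cylVol d T)
      + (∫ x, (∫ l, A l i ∂(ν₀ x)) * φ (x, 0)) = 0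
  /-- The averaged and integrated entropy inequality. -/
  entropy_ineq : ∀ ξ, IsTimeTest T ξ →
    0 ≤ (∫ z, deriv ξ z.2 * (∫ l, η l ∂(ν z)) ∂(cylVol d T)
        + ∫ z in cyl d T, deriv ξ z.2 ∂γ)
      + ((∫ x, ξ 0 * (∫ l, η l ∂(ν₀ x))) + ∫ _x, ξ 0 ∂γ₀)

end ConsLaw

/-! The proof is the relative entropy method of Dafermos and DiPerna, carried out in the conserved
variable `y = A u`. By (A1) and (A4) the map `A` is proper, so (H1) makes it a `C²` diffeomorphism.
Put `f = η ∘ A⁻¹` and `Γ = G ∘ A⁻¹`; then (H2) reads `∇f = Γ`. Differentiating (H2) gives `∇²η - G ·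
∇²A = ∇Gᵀ∇A`, so (H3) says exactly that `∇Γ = ∇²f` is positive definite. The same differentiation
applied to `q` shows that `∇Γᵀ∇F_α` is symmetric (`exists_conservedForm`).

Write `v = A(ū)` and `f(y|v) = f(y) - f(v) - Γ(v) · (y - v)`. Testing the averaged conservation laws
with `ξ(t) Γᵢ(v)` and subtracting from the entropy inequality gives `0 ≤ ∬ ⟨ν, ξ' f(A(λ)|v) - ξ S⟩`
(`integral_entropyBalance_nonneg`). Here the initial terms cancel because the data agree, and the
`γ` term can be dropped because `ξ' ≤ 0`. The equation for `v` and the symmetry of `∇Γᵀ∇F_α` reduce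
the source `S` to the relative fluxes `F_α(y) - F_α(v) - ∇F_α(v)(y - v)` paired with `∇Γ(v) ∂_α v`
(`source_eq`). These fluxes are bounded by a multiple of `f(y|v)`: quadratically on bounded sets,
and by the growth hypotheses at infinity (`exists_relative_flux_bound`).

No Gronwall argument at almost every time is needed. A weight with `ξ' ≤ -(C⁺ + 1) ξ` makes the
integrand at most `-ξ f(A(λ)|v)`. Its integral is nonnegative, so `f(A(λ)|v) = 0` wherever `ξ > 0`.
Strict convexity gives `A(λ) = A(ū)`, and injectivity of `A` gives the Dirac mass.

The remaining work is regularity, because `ξ Γᵢ(v)` is only a Lipschitz test function. A continuous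
function with bounded weak derivatives is shown to be Lipschitz (`norm_translate_sub_le`).
Rademacher's theorem then identifies weak and classical derivatives (`dirDeriv_ae_eq_of_weak`), and
mollification extends the weak form to Lipschitz tests (`weak_form_of_lipschitz`). -/

namespace ConsLaw

/-! ### Convexity: symmetry relations, Bregman divergence and relative flux. -/

section Pointwise

variable {V : Type*} [NormedAddCommGroup V] [InnerProductSpace ℝ V]

/-- If `∇q = Γ · ∇F` with `q`, `F` of class `C²`, then `∇Γᵀ ∇F` is symmetric. -/
theorem inner_fderiv_symm {q : V → ℝ} {Γ F : V → V} (hq : ContDiff ℝ 2 q) (hΓ : ContDiff ℝ 1 Γ)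
    (hF : ContDiff ℝ 2 F) (h : ∀ u v, fderiv ℝ q u v = inner ℝ (Γ u) (fderiv ℝ F u v)) (u v w : V) :
    fderiv ℝ (fderiv ℝ q) u v w =
        inner ℝ (fderiv ℝ Γ u v) (fderiv ℝ F u w) + inner ℝ (Γ u) (fderiv ℝ (fderiv ℝ F) u v w) ∧
      inner ℝ (fderiv ℝ Γ u v) (fderiv ℝ F u w) = inner ℝ (fderiv ℝ Γ u w) (fderiv ℝ F u v) := by
  have key : ∀ v w, fderiv ℝ (fderiv ℝ q) u v w =
        inner ℝ (fderiv ℝ Γ u v) (fderiv ℝ F u w) +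
          inner ℝ (Γ u) (fderiv ℝ (fderiv ℝ F) u v w) := by
    intro v w
    have hdq : DifferentiableAt ℝ (fderiv ℝ q) u :=
      (hq.fderiv_right (m := 1) (by norm_num)).differentiable one_ne_zero u
    have hdF : DifferentiableAt ℝ (fderiv ℝ F) u :=
      (hF.fderiv_right (m := 1) (by norm_num)).differentiable one_ne_zero u
    have e1 : HasFDerivAt (fun u => fderiv ℝ q u w)
        ((ContinuousLinearMap.apply ℝ ℝ w).comp (fderiv ℝ (fderiv ℝ q) u)) u :=
      (ContinuousLinearMap.apply ℝ ℝ w).hasFDerivAt.comp u hdq.hasFDerivAt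
    have e2 : HasFDerivAt (fun u => fderiv ℝ F u w)
        ((ContinuousLinearMap.apply ℝ V w).comp (fderiv ℝ (fderiv ℝ F) u)) u :=
      (ContinuousLinearMap.apply ℝ V w).hasFDerivAt.comp u hdF.hasFDerivAt
    have e3 := (hΓ.differentiable one_ne_zero u).hasFDerivAt.inner ℝ e2
    rw [funext fun u => h u w] at e1
    have := congrArg (fun L => L v) (e1.unique e3)
    simpa [fderivInnerCLM_apply, add_comm] using this
  refine ⟨key v w, ?_⟩
  -- Both second derivatives are symmetric, so comparing `key v w` with `key w v` leaves only the
  -- product terms.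
  have s1 := (hq.contDiffAt (x := u)).isSymmSndFDerivAt (by simp) v w
  have s2 := (hF.contDiffAt (x := u)).isSymmSndFDerivAt (by simp) v w
  have k1 := key v w
  have k2 := key w v
  rw [s1, s2] at k1
  linarith

variable [FiniteDimensional ℝ V]

theorem exists_lipschitzOnWith_closedBall {W W' : Type*} [NormedAddCommGroup W] [NormedSpace ℝ W]
    [FiniteDimensional ℝ W] [NormedAddCommGroup W'] [NormedSpace ℝ W'] {g : W → W'}
    (hg : ContDiff ℝ 1 g) (R : ℝ) : ∃ K : ℝ≥0, LipschitzOnWith K g (Metric.closedBall 0 R) := by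
  obtain ⟨C, hC⟩ := (isCompact_closedBall (0 : W) R).exists_bound_of_continuousOn
    (hg.continuous_fderiv one_ne_zero).continuousOn
  refine ⟨C.toNNReal, (convex_closedBall (0 : W) R).lipschitzOnWith_of_nnnorm_fderiv_le
    (𝕜 := ℝ) (fun x _ => (hg.differentiable one_ne_zero) x) fun x hx => ?_⟩
  rw [← NNReal.coe_le_coe, coe_nnnorm]
  exact (hC x hx).trans (Real.le_coe_toNNReal C)

/-- Quadratic lower bound for the Bregman divergence of a function with positive Hessian. -/
theorem exists_bregman_lower_bound {f : V → ℝ} {Γ : V → V}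
    (hf : ∀ y, HasFDerivAt f (innerSL ℝ (Γ y)) y) (hΓ : ContDiff ℝ 1 Γ)
    (hpos : ∀ y h, h ≠ 0 → 0 < inner ℝ (fderiv ℝ Γ y h) h) (R : ℝ) :
    ∃ m > 0, ∀ y ∈ Metric.closedBall (0 : V) R, ∀ y' ∈ Metric.closedBall (0 : V) R,
      m * ‖y - y'‖ ^ 2 ≤ f y - f y' - inner ℝ (Γ y') (y - y') := by
  have hcD : Continuous (fderiv ℝ Γ) := hΓ.continuous_fderiv one_ne_zero
  -- The Hessian form is minimised over ball times unit sphere, which is compact; homogeneity then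
  -- covers all directions.
  obtain ⟨m, hm, hmin⟩ := ((isCompact_closedBall (0 : V) R).prod
    (isCompact_sphere (0 : V) 1)).exists_forall_le' (a := 0)
    (f := fun p : V × V => inner ℝ (fderiv ℝ Γ p.1 p.2) p.2) (by fun_prop)
    (fun p hp => hpos p.1 p.2 (by
      rintro h0
      have := hp.2
      simp [h0] at this))
  have hmin' : ∀ y ∈ Metric.closedBall (0 : V) R, ∀ h : V,
      m * ‖h‖ ^ 2 ≤ inner ℝ (fderiv ℝ Γ y h) h := by
    intro y hy h
    rcases eq_or_ne h 0 with rfl | h0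
    · simp
    have hn : ‖h‖ ≠ 0 := norm_ne_zero_iff.2 h0
    have := hmin (y, ‖h‖⁻¹ • h) ⟨hy, by simp [norm_smul, hn]⟩
    simp only [map_smul, inner_smul_left, inner_smul_right] at this
    have h2 := mul_le_mul_of_nonneg_right this (sq_nonneg ‖h‖)
    refine h2.trans_eq ?_
    simp only [map_inv₀, conj_trivial]
    field_simp
  -- The Hessian bound is integrated twice along the segment, each time as a monotonicity statement
  -- in `s`; the factor `1/2` is the integral of `s` over `[0,1]`.
  refine ⟨m / 2, by positivity, fun y hy y' hy' => ?_⟩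
  set h := y - y' with hh
  have hseg : ∀ s ∈ Set.Icc (0 : ℝ) 1, y' + s • h ∈ Metric.closedBall (0 : V) R := fun s hs =>
    (convex_closedBall (0 : V) R).add_smul_sub_mem hy' hy hs
  have hline : ∀ s : ℝ, HasDerivAt (fun s : ℝ => y' + s • h) h s := fun s => by
    simpa using ((hasDerivAt_id s).smul_const h).const_add y'
  have hΓd : ∀ s : ℝ, HasDerivAt (fun s : ℝ => Γ (y' + s • h)) (fderiv ℝ Γ (y' + s • h) h) s :=
    fun s => (hΓ.differentiable one_ne_zero _).hasFDerivAt.comp_hasDerivAt s (hline s)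
  have hψd : ∀ s : ℝ, HasDerivAt (fun s : ℝ => inner ℝ (Γ (y' + s • h) - Γ y') h - m * s * ‖h‖ ^ 2)
      (inner ℝ (fderiv ℝ Γ (y' + s • h) h) h - m * ‖h‖ ^ 2) s := fun s => by
    have h1 := ((hΓd s).sub_const (Γ y')).inner ℝ (hasDerivAt_const s h)
    have h2 := ((hasDerivAt_id s).const_mul m).mul_const (‖h‖ ^ 2)
    exact (h1.sub h2).congr_deriv (by simp)
  have hψ : ∀ s ∈ Set.Icc (0 : ℝ) 1, 0 ≤ inner ℝ (Γ (y' + s • h) - Γ y') h - m * s * ‖h‖ ^ 2 := by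
    intro s hs
    have := monotoneOn_of_deriv_nonneg (convex_Icc (0 : ℝ) 1)
      (fun s _ => (hψd s).continuousAt.continuousWithinAt)
      (fun s _ => (hψd s).differentiableAt.differentiableWithinAt)
      (fun s hs => by
        rw [(hψd s).deriv]
        exact sub_nonneg.2 (hmin' _ (hseg s (interior_subset hs)) h))
      (Set.left_mem_Icc.2 zero_le_one) hs hs.1
    simpa using this
  have hφd : ∀ s : ℝ, HasDerivAt
      (fun s : ℝ => f (y' + s • h) - s * inner ℝ (Γ y') h - m / 2 * s ^ 2 * ‖h‖ ^ 2)
      (inner ℝ (Γ (y' + s • h) - Γ y') h - m * s * ‖h‖ ^ 2) s := fun s => by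
    have h1 := (hf (y' + s • h)).comp_hasDerivAt s (hline s)
    have h2 := (hasDerivAt_id s).mul_const (inner ℝ (Γ y') h)
    have h3 := ((hasDerivAt_pow 2 s).const_mul (m / 2)).mul_const (‖h‖ ^ 2)
    refine ((h1.sub h2).sub h3).congr_deriv ?_
    simp only [innerSL_apply_apply, inner_sub_left, one_mul]
    push_cast
    ring
  have := monotoneOn_of_deriv_nonneg (convex_Icc (0 : ℝ) 1)
      (fun s _ => (hφd s).continuousAt.continuousWithinAt)
      (fun s _ => (hφd s).differentiableAt.differentiableWithinAt)
      (fun s hs => by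
        rw [(hφd s).deriv]
        exact hψ s (interior_subset hs))
      (Set.left_mem_Icc.2 zero_le_one) (Set.right_mem_Icc.2 zero_le_one) zero_le_one
  have hyy : y' + h = y := by simp [hh]
  simp only [zero_smul, add_zero, one_smul, hyy] at this
  linarith

theorem bregman_pos {f : V → ℝ} {Γ : V → V}
    (hf : ∀ y, HasFDerivAt f (innerSL ℝ (Γ y)) y) (hΓ : ContDiff ℝ 1 Γ)
    (hpos : ∀ y h, h ≠ 0 → 0 < inner ℝ (fderiv ℝ Γ y h) h) {y y' : V} (hne : y ≠ y') :
    0 < f y - f y' - inner ℝ (Γ y') (y - y') := by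
  obtain ⟨m, hm, h⟩ := exists_bregman_lower_bound hf hΓ hpos (max ‖y‖ ‖y'‖)
  have := h y (by simp) y' (by simp)
  have h0 : 0 < ‖y - y'‖ := norm_pos_iff.2 (sub_ne_zero.2 hne)
  exact (by positivity : 0 < m * ‖y - y'‖ ^ 2).trans_le this

theorem bregman_nonneg {f : V → ℝ} {Γ : V → V}
    (hf : ∀ y, HasFDerivAt f (innerSL ℝ (Γ y)) y) (hΓ : ContDiff ℝ 1 Γ)
    (hpos : ∀ y h, h ≠ 0 → 0 < inner ℝ (fderiv ℝ Γ y h) h) (y y' : V) :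
    0 ≤ f y - f y' - inner ℝ (Γ y') (y - y') := by
  rcases eq_or_ne y y' with rfl | hne
  · simp
  · exact (bregman_pos hf hΓ hpos hne).le

/-- Second-order Taylor bound on balls. -/
theorem exists_taylor_upper_bound {F : V → V} (hF : ContDiff ℝ 2 F) (R : ℝ) :
    ∃ C ≥ 0, ∀ y ∈ Metric.closedBall (0 : V) R, ∀ y' ∈ Metric.closedBall (0 : V) R,
      ‖F y - F y' - fderiv ℝ F y' (y - y')‖ ≤ C * ‖y - y'‖ ^ 2 := by
  obtain ⟨K, hK⟩ := exists_lipschitzOnWith_closedBall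
    (hF.fderiv_right (m := 1) (by norm_num)) R
  refine ⟨K, K.2, fun y hy y' hy' => ?_⟩
  have hsub : segment ℝ y' y ⊆ Metric.closedBall (0 : V) R :=
    (convex_closedBall (0 : V) R).segment_subset hy' hy
  have := (convex_segment (𝕜 := ℝ) y' y).norm_image_sub_le_of_norm_fderiv_le' (𝕜 := ℝ) (f := F)
    (C := K * ‖y - y'‖) (φ := fderiv ℝ F y')
    (fun x _ => hF.differentiable two_ne_zero x) (fun x hx => by
      refine (hK.norm_sub_le (hsub hx) hy').trans ?_
      gcongr
      have := norm_sub_le_of_mem_segment hx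
      simpa [norm_sub_rev] using this) (left_mem_segment ℝ y' y) (right_mem_segment ℝ y' y)
  calc _ ≤ _ := this
    _ = _ := by ring

/-- The relative flux is controlled by the relative entropy, uniformly on bounded sets of the
reference state. -/
theorem exists_relative_flux_bound {f : V → ℝ} {Γ : V → V} {F : V → V}
    (hf : ∀ y, HasFDerivAt f (innerSL ℝ (Γ y)) y) (hΓ : ContDiff ℝ 1 Γ)
    (hpos : ∀ y h, h ≠ 0 → 0 < inner ℝ (fderiv ℝ Γ y h) h) (hF : ContDiff ℝ 2 F)
    (hinf : Tendsto f (cocompact V) atTop)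
    (hFo : Tendsto (fun y => ‖F y‖ / f y) (cocompact V) (𝓝 0))
    (hIo : Tendsto (fun y => ‖y‖ / f y) (cocompact V) (𝓝 0)) (R : ℝ) :
    ∃ C ≥ 0, ∀ y' ∈ Metric.closedBall (0 : V) R, ∀ y,
      ‖F y - F y' - fderiv ℝ F y' (y - y')‖ ≤ C * (f y - f y' - inner ℝ (Γ y') (y - y')) := by
  have hK := isCompact_closedBall (0 : V) R
  have hfc : Continuous f := continuous_iff_continuousAt.2 fun y => (hf y).continuousAt
  obtain ⟨c1, h1⟩ := hK.exists_bound_of_continuousOn hfc.continuousOn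
  obtain ⟨c2, h2⟩ := hK.exists_bound_of_continuousOn hΓ.continuous.continuousOn
  obtain ⟨c3, h3⟩ := hK.exists_bound_of_continuousOn hF.continuous.continuousOn
  obtain ⟨c4, h4⟩ := hK.exists_bound_of_continuousOn
    (hF.continuous_fderiv two_ne_zero).continuousOn
  -- The constants are tuned so that far out the Bregman divergence is at least `f y / 2` (`hH`):
  -- one quarter of `f y` absorbs the term linear in `y`, another absorbs `|c1| + |c2| * |R|`. The
  -- lower bound `1 ≤ f y` lets `f y` absorb the other constants.
  have hε : 0 < 1 / (4 * (|c2| + 1)) := by positivity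
  have hev : ∀ᶠ y in cocompact V, max 1 (4 * (|c1| + |c2| * |R|)) ≤ f y ∧ ‖F y‖ ≤ f y ∧
      ‖y‖ ≤ f y ∧ ‖y‖ ≤ 1 / (4 * (|c2| + 1)) * f y := by
    filter_upwards [hinf.eventually_ge_atTop (max 1 (4 * (|c1| + |c2| * |R|))),
      hFo.eventually_le_const zero_lt_one, hIo.eventually_le_const zero_lt_one,
      hIo.eventually_le_const hε] with y ha hb hc hd
    have hp : 0 < f y := lt_of_lt_of_le (by positivity) ha
    exact ⟨ha, by simpa using (div_le_iff₀ hp).1 hb, by simpa using (div_le_iff₀ hp).1 hc,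
      (div_le_iff₀ hp).1 hd⟩
  obtain ⟨t, ht, htc⟩ := mem_cocompact.1 hev
  obtain ⟨R', hR'⟩ := ht.isBounded.subset_closedBall (0 : V)
  obtain ⟨m, hm, hlow⟩ := exists_bregman_lower_bound hf hΓ hpos (max R R')
  obtain ⟨C, hC0, hup⟩ := exists_taylor_upper_bound hF (max R R')
  refine ⟨max (C / m) (2 * (1 + |c3| + |c4| * (1 + |R|))), by positivity, fun y' hy' y => ?_⟩
  have hy'R : ‖y'‖ ≤ |R| := (mem_closedBall_zero_iff.1 hy').trans (le_abs_self R)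
  have hb0 := bregman_nonneg hf hΓ hpos y y'
  -- On the compact set both sides are comparable to `‖y - y'‖ ^ 2`; outside it both are compared
  -- with `f y`.
  by_cases hy : y ∈ t
  · have hyb := Metric.closedBall_subset_closedBall (le_max_right R R') (hR' hy)
    have hyb' := Metric.closedBall_subset_closedBall (le_max_left R R') hy'
    calc _ ≤ C * ‖y - y'‖ ^ 2 := hup y hyb y' hyb'
      _ = C / m * (m * ‖y - y'‖ ^ 2) := by field_simp
      _ ≤ C / m * (f y - f y' - inner ℝ (Γ y') (y - y')) := by gcongr; exact hlow y hyb y' hyb'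
      _ ≤ _ := by gcongr; exact le_max_left _ _
  · obtain ⟨ha, hb, hc, hd⟩ := htc hy
    have ha1 := (le_max_left _ _).trans ha
    have ha2 := (le_max_right _ _).trans ha
    have e1 : |f y'| ≤ |c1| := (h1 y' hy').trans (le_abs_self _)
    have e2 : ‖Γ y'‖ ≤ |c2| := (h2 y' hy').trans (le_abs_self _)
    have e3 : ‖F y'‖ ≤ |c3| := (h3 y' hy').trans (le_abs_self _)
    have e4 : ‖fderiv ℝ F y'‖ ≤ |c4| := (h4 y' hy').trans (le_abs_self _)
    have hsub : ‖y - y'‖ ≤ ‖y‖ + |R| := (norm_sub_le _ _).trans (by gcongr)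
    have hin : inner ℝ (Γ y') (y - y') ≤ |c2| * (1 / (4 * (|c2| + 1)) * f y + |R|) :=
      (real_inner_le_norm _ _).trans
        (mul_le_mul e2 (hsub.trans (by gcongr)) (norm_nonneg _) (abs_nonneg _))
    have hq : |c2| * (1 / (4 * (|c2| + 1)) * f y) ≤ f y / 4 := by
      rw [← mul_assoc, mul_one_div, div_mul_eq_mul_div, div_le_div_iff₀ (by positivity) (by norm_num)]
      nlinarith [abs_nonneg c2]
    have hH : f y / 2 ≤ f y - f y' - inner ℝ (Γ y') (y - y') := by
      have := (abs_le.1 e1).2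
      nlinarith
    have hD : ‖fderiv ℝ F y' (y - y')‖ ≤ |c4| * (f y + |R|) :=
      (ContinuousLinearMap.le_opNorm _ _).trans
        (mul_le_mul e4 (hsub.trans (by gcongr)) (norm_nonneg _) (abs_nonneg _))
    have hZ : ‖F y - F y' - fderiv ℝ F y' (y - y')‖ ≤ f y + |c3| + |c4| * (f y + |R|) :=
      (norm_sub_le _ _).trans (add_le_add ((norm_sub_le _ _).trans (add_le_add hb e3)) hD)
    calc _ ≤ f y + |c3| + |c4| * (f y + |R|) := hZ
      _ ≤ (1 + |c3| + |c4| * (1 + |R|)) * f y := by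
          have i3 := mul_le_mul_of_nonneg_left ha1 (abs_nonneg c3)
          have i4 := mul_le_mul_of_nonneg_left ha1 (mul_nonneg (abs_nonneg c4) (abs_nonneg R))
          nlinarith
      _ = 2 * (1 + |c3| + |c4| * (1 + |R|)) * (f y / 2) := by ring
      _ ≤ 2 * (1 + |c3| + |c4| * (1 + |R|)) * (f y - f y' - inner ℝ (Γ y') (y - y')) := by gcongr
      _ ≤ _ := by gcongr; exact le_max_right _ _

end Pointwise

/-! ### Passage to the conserved variable. -/

/-- The constitutive functions in terms of the conserved variable `v = A(u)`: `f` is a strictly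
convex entropy with gradient `Γ`, and `q α` is the entropy flux belonging to the flux `F α`. -/
structure ConservedForm {n d : ℕ} (f : State n → ℝ) (Γ : State n → State n)
    (F : Fin d → State n → State n) (q : Fin d → State n → ℝ) : Prop where
  contDiff_grad : ContDiff ℝ 1 Γ
  contDiff_flux : ∀ α, ContDiff ℝ 2 (F α)
  contDiff_q : ∀ α, ContDiff ℝ 1 (q α)
  contDiff_f : ContDiff ℝ 1 f
  hasFDerivAt : ∀ y, HasFDerivAt f (innerSL ℝ (Γ y)) y
  fderiv_q : ∀ α y v, fderiv ℝ (q α) y v = inner ℝ (Γ y) (fderiv ℝ (F α) y v)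
  pos : ∀ y h, h ≠ 0 → 0 < inner ℝ (fderiv ℝ Γ y h) h
  symm : ∀ y v w, inner ℝ (fderiv ℝ Γ y v) w = inner ℝ (fderiv ℝ Γ y w) v
  symm_flux : ∀ α y v w, inner ℝ (fderiv ℝ Γ y v) (fderiv ℝ (F α) y w) =
    inner ℝ (fderiv ℝ Γ y w) (fderiv ℝ (F α) y v)
  tendsto_atTop : Tendsto f (cocompact (State n)) atTop
  flux_little : ∀ α, Tendsto (fun y => ‖F α y‖ / f y) (cocompact (State n)) (𝓝 0)
  id_little : Tendsto (fun y => ‖y‖ / f y) (cocompact (State n)) (𝓝 0)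

theorem HypA1.tendsto_atTop {n : ℕ} {η : State n → ℝ} {p : ℝ} (hp : 1 < p) (h : HypA1 η p) :
    Tendsto η (cocompact (State n)) atTop := by
  obtain ⟨β₁, β₂, B, h1, h2, hB, h⟩ := h
  refine tendsto_atTop_mono (fun u => (h u).1) ?_
  refine tendsto_atTop_add_const_right _ _ (Tendsto.const_mul_atTop h1 ?_)
  exact tendsto_atTop_add_const_right _ _
    ((tendsto_rpow_atTop (by linarith)).comp (tendsto_norm_cocompact_atTop (E := State n)))

/-- Only the upper bound in (A4) matters: `η` tends to infinity and is dominated by `‖A u‖ ^ r + 1`,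
so `A` is proper. -/
theorem HypA4.tendsto_cocompact {n : ℕ} {A : State n → State n} {η : State n → ℝ}
    (h : HypA4 A η) (hη : Tendsto η (cocompact (State n)) atTop) :
    Tendsto A (cocompact (State n)) (cocompact (State n)) := by
  obtain ⟨r, C, B, hr, hC, hB, h⟩ := h
  rw [← Metric.cobounded_eq_cocompact, ← comap_norm_atTop, tendsto_comap_iff,
    comap_norm_atTop, Metric.cobounded_eq_cocompact]
  have h1 : Tendsto (fun u => ‖A u‖ ^ r) (cocompact (State n)) atTop := by
    refine tendsto_atTop_mono (f := fun u => C⁻¹ * η u + (-1)) (fun u => ?_)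
      (tendsto_atTop_add_const_right _ _ (hη.const_mul_atTop (by positivity)))
    have := mul_le_mul_of_nonneg_left (h u).2 (by positivity : 0 ≤ C⁻¹)
    rw [inv_mul_cancel_left₀ hC.ne'] at this
    linarith
  refine tendsto_atTop.2 fun M => ?_
  filter_upwards [h1.eventually_gt_atTop (|M| ^ r)] with u hu
  exact (le_abs_self M).trans
    (le_of_lt ((Real.rpow_lt_rpow_iff (abs_nonneg _) (norm_nonneg _) (by linarith)).1 hu))

/-- A proper `C²` injection with invertible derivatives is a `C²` diffeomorphism. -/
theorem HypH1.exists_homeomorph {n : ℕ} {A : State n → State n} (h : HypH1 A)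
    (hA : Tendsto A (cocompact (State n)) (cocompact (State n))) :
    ∃ e : State n ≃ₜ State n, ⇑e = A ∧ ContDiff ℝ 2 e.symm := by
  choose A' hA' using h.nonsingular
  have hder : ∀ u, HasFDerivAt A (A' u : State n →L[ℝ] State n) u := fun u => by
    rw [hA' u]
    exact (h.contDiff.differentiable two_ne_zero u).hasFDerivAt
  have hopen : IsOpenMap A := isOpenMap_of_hasStrictFDerivAt_equiv fun u =>
    h.contDiff.contDiffAt.hasStrictFDerivAt' (hder u) two_ne_zero
  have hclosed : IsClosed (Set.range A) :=
    ((isProperMap_iff_tendsto_cocompact).2 ⟨h.contDiff.continuous, hA⟩).isClosedMap.isClosed_range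
  -- The range is open by the inverse function theorem and closed by properness, and the state space
  -- is connected.
  have hsurj : Function.Surjective A := Set.range_eq_univ.1
    (IsClopen.eq_univ ⟨hclosed, hopen.isOpen_range⟩ (Set.range_nonempty A))
  let e : State n ≃ₜ State n :=
    (Equiv.ofBijective A ⟨h.injective, hsurj⟩).toHomeomorphOfContinuousOpen
      h.contDiff.continuous hopen
  exact ⟨e, rfl, e.contDiff_symm (f₀' := A') hder h.contDiff⟩

/-- Each hypothesis is transported by the inverse diffeomorphism, which is itself proper, so limits
at infinity are preserved. Gradients transform well because the multiplier pairs with `∇A`, and `∇A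
∇(A⁻¹)` is the identity. -/
theorem exists_conservedForm {n d : ℕ} {A : State n → State n}
    {F : Fin d → State n → State n}
    {η : State n → ℝ} {q : Fin d → State n → ℝ} {G : State n → State n}
    (hF : ∀ α, ContDiff ℝ 2 (F α))
    (hH1 : HypH1 A) (hH2 : HypH2 A F η q G) (hH3 : HypH3 A η G)
    {p : ℝ} (hp : 1 < p) (hA1 : HypA1 η p) (hA2 : HypA2 F η)
    (hA3 : HypA3 A η) (hA4 : HypA4 A η) :
    ∃ e : State n ≃ₜ State n, ⇑e = A ∧
      ConservedForm (η ∘ e.symm) (G ∘ e.symm) (fun α => F α ∘ e.symm) (fun α => q α ∘ e.symm) := by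
  have hη := hA1.tendsto_atTop hp
  obtain ⟨e, he, hes⟩ := hH1.exists_homeomorph (hA4.tendsto_cocompact hη)
  refine ⟨e, he, ?_⟩
  have hesd : ∀ y, HasFDerivAt e.symm (fderiv ℝ e.symm y) y := fun y =>
    (hes.differentiable two_ne_zero y).hasFDerivAt
  have hinv : ∀ y v, fderiv ℝ A (e.symm y) (fderiv ℝ e.symm y v) = v := by
    intro y v
    have h1 := (hH1.contDiff.differentiable two_ne_zero (e.symm y)).hasFDerivAt.comp y (hesd y)
    have h2 : A ∘ e.symm = id := by
      rw [← he]
      funext y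
      simp
    rw [h2] at h1
    exact congrArg (fun L => L v) (h1.unique (hasFDerivAt_id y))
  have hΓ : ContDiff ℝ 1 (G ∘ e.symm) := hH2.contDiff_G.comp (hes.of_le one_le_two)
  have hf2 : ContDiff ℝ 2 (η ∘ e.symm) := hH2.contDiff_eta.comp hes
  have hF2 : ∀ α, ContDiff ℝ 2 (F α ∘ e.symm) := fun α => (hF α).comp hes
  have hq2 : ∀ α, ContDiff ℝ 2 (q α ∘ e.symm) := fun α => (hH2.contDiff_q α).comp hes
  have hfd : ∀ y, HasFDerivAt (η ∘ e.symm) (innerSL ℝ ((G ∘ e.symm) y)) y := by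
    intro y
    refine ((hH2.contDiff_eta.differentiable two_ne_zero _).hasFDerivAt.comp y
      (hesd y)).congr_fderiv ?_
    ext v
    simp [hH2.grad_eta, hinv]
  have hqd : ∀ α y v, fderiv ℝ (q α ∘ e.symm) y v =
      inner ℝ ((G ∘ e.symm) y) (fderiv ℝ (F α ∘ e.symm) y v) := by
    intro α y v
    rw [(((hH2.contDiff_q α).differentiable two_ne_zero _).hasFDerivAt.comp y (hesd y)).fderiv,
      (((hF α).differentiable two_ne_zero _).hasFDerivAt.comp y (hesd y)).fderiv]
    simp [hH2.grad_q]
  have hΓd : ∀ y v, fderiv ℝ (G ∘ e.symm) y v = fderiv ℝ G (e.symm y) (fderiv ℝ e.symm y v) := by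
    intro y v
    rw [((hH2.contDiff_G.differentiable one_ne_zero _).hasFDerivAt.comp y (hesd y)).fderiv]
    rfl
  have hcc : Tendsto e.symm (cocompact (State n)) (cocompact (State n)) :=
    e.symm.isClosedEmbedding.tendsto_cocompact
  refine ⟨hΓ, hF2, fun α => (hq2 α).of_le one_le_two, hf2.of_le one_le_two, hfd, hqd, ?_, ?_,
    fun α y v w => (inner_fderiv_symm (hq2 α) hΓ (hF2 α) (hqd α) y v w).2,
    hη.comp hcc, fun α => (hA2 α).comp hcc, ?_⟩
  -- Positivity of `∇Γ` in direction `h` is (H3) in direction `∇(A⁻¹) h`, once `∇²η - G · ∇²A` is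
  -- replaced by `∇Gᵀ∇A`.
  · intro y h h0
    have h1 := (inner_fderiv_symm hH2.contDiff_eta hH2.contDiff_G hH1.contDiff hH2.grad_eta
      (e.symm y) (fderiv ℝ e.symm y h) (fderiv ℝ e.symm y h)).1
    have h2 := hH3 (e.symm y) (fderiv ℝ e.symm y h) (by
      intro h3
      have := hinv y h
      rw [h3, map_zero] at this
      exact h0 this.symm)
    rw [h1, hinv] at h2
    rw [hΓd]
    linarith
  -- Taking the identity as flux, the symmetry lemma says that `∇Γ`, being a Hessian, is symmetric.
  · intro y v w
    have := (inner_fderiv_symm hf2 hΓ (F := id) contDiff_id (fun u v => by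
      simp [(hfd u).fderiv]) y v w).2
    simpa using this
  · refine (hA3.comp hcc).congr fun y => ?_
    simp [← he]

/-! ### Calculus on the torus through its universal cover. -/

section Torus

variable {d : ℕ}

/-- The universal cover `ℝᵈ × ℝ` of `𝕋ᵈ × ℝ`. -/
abbrev Cover (d : ℕ) : Type := (Fin d → ℝ) × ℝ

instance isAddHaarMeasure_cover : (volume : Measure (Cover d)).IsAddHaarMeasure :=
  Measure.prod.instIsAddHaarMeasure _ _

instance isAddHaarMeasure_torus_prod : (volume : Measure (Torus d × ℝ)).IsAddHaarMeasure :=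
  Measure.prod.instIsAddHaarMeasure _ _

/-- The covering map. -/
noncomputable def proj (d : ℕ) : Cover d →+ Torus d × ℝ where
  toFun y := (fun i => (y.1 i : AddCircle (2 * Real.pi)), y.2)
  map_zero' := rfl
  map_add' _ _ := rfl

theorem proj_apply (y : Cover d) :
    proj d y = (fun i => (y.1 i : AddCircle (2 * Real.pi)), y.2) := rfl

@[simp] theorem proj_snd (y : Cover d) : (proj d y).2 = y.2 := rfl

theorem lift_eq (φ : Torus d × ℝ → ℝ) : lift φ = φ ∘ proj d := rfl

/-- A measurable section of the covering map. -/
noncomputable def sect (z : Torus d × ℝ) : Cover d :=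
  (fun i => (AddCircle.measurableEquivIoc (2 * Real.pi) 0 (z.1 i) : ℝ), z.2)

@[simp] theorem sect_snd (z : Torus d × ℝ) : (sect z).2 = z.2 := rfl

@[simp] theorem proj_sect (z : Torus d × ℝ) : proj d (sect z) = z := by
  ext i
  · exact AddCircle.coe_equivIoc
  · rfl

/-- The section carries Lebesgue measure to its restriction to a fundamental box. Almost-everywhere
statements on the cover, Rademacher's theorem above all, therefore descend to the torus. -/
theorem quasiMeasurePreserving_sect :
    Measure.QuasiMeasurePreserving (sect (d := d)) volume volume := by
  have h1 : MeasurePreserving (fun x : AddCircle (2 * Real.pi) =>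
      ((AddCircle.measurableEquivIoc (2 * Real.pi) 0 x : Set.Ioc (0 : ℝ) (0 + 2 * Real.pi)) : ℝ))
      volume (volume.restrict (Set.Ioc (0 : ℝ) (0 + 2 * Real.pi))) :=
    (measurePreserving_subtype_coe measurableSet_Ioc).comp
      (AddCircle.measurePreserving_equivIoc (2 * Real.pi) (a := 0))
  have h2 := measurePreserving_pi (fun _ : Fin d => (volume : Measure (AddCircle (2 * Real.pi))))
    (fun _ : Fin d => (volume.restrict (Set.Ioc (0 : ℝ) (0 + 2 * Real.pi)))) (fun _ => h1)
  have h3 := (h2.prod (MeasurePreserving.id (volume : Measure ℝ))).quasiMeasurePreserving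
  refine h3.mono_right ?_
  rw [← Measure.restrict_pi_pi]
  exact Measure.AbsolutelyContinuous.prod Measure.restrict_le_self.absolutelyContinuous
    Measure.AbsolutelyContinuous.rfl

theorem measurable_sect : Measurable (sect (d := d)) := quasiMeasurePreserving_sect.measurable

theorem ae_sect {Q : Cover d → Prop} (h : ∀ᵐ y, Q y) : ∀ᵐ z : Torus d × ℝ, Q (sect z) :=
  quasiMeasurePreserving_sect.ae h

variable {W : Type*} [NormedAddCommGroup W] [NormedSpace ℝ W]

/-- The derivative in the direction `v` of a function on `𝕋ᵈ × ℝ`. -/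
noncomputable def dirDeriv (v : Cover d) (f : Torus d × ℝ → W) (z : Torus d × ℝ) : W :=
  lineDeriv ℝ (f ∘ proj d) (sect z) v

theorem dirDeriv_eq_deriv (v : Cover d) (f : Torus d × ℝ → W) (z : Torus d × ℝ) :
    dirDeriv v f z = deriv (fun s : ℝ => f (z + proj d (s • v))) 0 := by
  simp [dirDeriv, lineDeriv]

/-- The unit vector in the time direction. -/
def timeDir (d : ℕ) : Cover d := (0, 1)

/-- The unit vector in the direction `x_α`. -/
def spaceDir (α : Fin d) : Cover d := (Pi.single α 1, 0)

theorem proj_timeDir (s : ℝ) : proj d (s • timeDir d) = (0, s) := by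
  ext i <;> simp [proj_apply, timeDir]

theorem proj_spaceDir (α : Fin d) (s : ℝ) :
    proj d (s • spaceDir α) = (Pi.single α (s : AddCircle (2 * Real.pi)), 0) := by
  ext i
  · rcases eq_or_ne i α with rfl | h
    · simp [proj_apply, spaceDir]
    · simp [proj_apply, spaceDir, h]
  · simp [proj_apply, spaceDir]

theorem dt_eq (φ : Torus d × ℝ → ℝ) (z : Torus d × ℝ) : dt φ z = dirDeriv (timeDir d) φ z := by
  rw [dirDeriv_eq_deriv, dt]
  simp only [proj_timeDir]
  have := deriv_comp_const_add (fun s => φ (z.1, s)) z.2 0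
  rw [add_zero] at this
  rw [← this]
  simp [Prod.add_def]

theorem dx_eq (α : Fin d) (φ : Torus d × ℝ → ℝ) (z : Torus d × ℝ) :
    dx α φ z = dirDeriv (spaceDir α) φ z := by
  rw [dirDeriv_eq_deriv, dx]
  simp [proj_spaceDir, Prod.add_def]

theorem measurable_dirDeriv [CompleteSpace W] [MeasurableSpace W] [BorelSpace W] {v : Cover d}
    {f : Torus d × ℝ → W} (hf : Continuous (f ∘ proj d)) : Measurable (dirDeriv v f) :=
  (measurable_lineDeriv (𝕜 := ℝ) (v := v) hf).comp measurable_sect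

theorem norm_dirDeriv_le {v : Cover d} {f : Torus d × ℝ → W} {K : ℝ≥0}
    (hf : LipschitzWith K (f ∘ proj d)) (z : Torus d × ℝ) : ‖dirDeriv v f z‖ ≤ K * ‖v‖ :=
  norm_lineDeriv_le_of_lipschitz ℝ hf

theorem ae_differentiableAt_sect [FiniteDimensional ℝ W] {f : Torus d × ℝ → W} {K : ℝ≥0}
    (hf : LipschitzWith K (f ∘ proj d)) :
    ∀ᵐ z : Torus d × ℝ, DifferentiableAt ℝ (f ∘ proj d) (sect z) :=
  ae_sect hf.ae_differentiableAt

theorem dirDeriv_eq_fderiv {v : Cover d} {f : Torus d × ℝ → W} {z : Torus d × ℝ}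
    (h : DifferentiableAt ℝ (f ∘ proj d) (sect z)) :
    dirDeriv v f z = fderiv ℝ (f ∘ proj d) (sect z) v :=
  h.lineDeriv_eq_fderiv

theorem isOpenQuotientMap_proj : IsOpenQuotientMap (proj d) := by
  have h : IsOpenQuotientMap (Prod.map (Pi.map fun _ : Fin d =>
      ((↑) : ℝ → AddCircle (2 * Real.pi))) (id : ℝ → ℝ)) :=
    (IsOpenQuotientMap.piMap fun _ => QuotientAddGroup.isOpenQuotientMap_mk).prodMap .id
  exact h

theorem continuous_of_comp_proj {X : Type*} [TopologicalSpace X] {f : Torus d × ℝ → X}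
    (h : Continuous (f ∘ proj d)) : Continuous f :=
  isOpenQuotientMap_proj.isQuotientMap.continuous_iff.2 h

instance isFiniteMeasure_cylVol (T : ℝ) : IsFiniteMeasure (cylVol d T) := by
  constructor
  rw [cylVol, Measure.restrict_apply_univ, cyl, Measure.volume_eq_prod, Measure.prod_prod]
  exact ENNReal.mul_lt_top (measure_lt_top _ _) (by simp)

theorem cylVol_eq_prod (T : ℝ) :
    cylVol d T = (volume : Measure (Torus d)).prod (volume.restrict (Set.Ico 0 T)) := by
  rw [cylVol, cyl, Measure.volume_eq_prod, ← Measure.prod_restrict, Measure.restrict_univ]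

theorem measurableSet_cyl (T : ℝ) : MeasurableSet (cyl d T) :=
  MeasurableSet.univ.prod measurableSet_Ico

theorem ae_cylVol_of_ae {T : ℝ} {P : Torus d × ℝ → Prop} (h : ∀ᵐ z, P z) :
    ∀ᵐ z ∂(cylVol d T), P z := ae_restrict_of_ae h

theorem ae_cylVol_mem_Ioo (T : ℝ) : ∀ᵐ z ∂(cylVol d T), z.2 ∈ Set.Ioo 0 T := by
  rw [cylVol_eq_prod]
  have h : ∀ᵐ t ∂(volume.restrict (Set.Ico 0 T)), t ∈ Set.Ioo (0 : ℝ) T := by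
    rw [← restrict_Ioo_eq_restrict_Ico]
    exact ae_restrict_mem measurableSet_Ioo
  exact Measure.quasiMeasurePreserving_snd.ae h

/-- A Lipschitz function has vanishing mean space derivatives. -/
theorem integral_dirDeriv_of_snd_eq_zero {T : ℝ} {v : Cover d} (hv : v.2 = 0)
    {φ : Torus d × ℝ → ℝ} {K : ℝ≥0} (hφ : LipschitzWith K (φ ∘ proj d)) :
    ∫ z, dirDeriv v φ z ∂(cylVol d T) = 0 := by
  have hc : Continuous φ := continuous_of_comp_proj hφ.continuous
  have hint : Integrable φ (cylVol d T) := by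
    have h1 : IntegrableOn φ (Set.univ ×ˢ Set.Icc 0 T) :=
      hc.continuousOn.integrableOn_compact (isCompact_univ.prod isCompact_Icc)
    exact h1.mono_set (Set.prod_mono_right Set.Ico_subset_Icc_self)
  -- Difference quotients along this sequence have mean zero by translation invariance in space.
  -- They are bounded by the Lipschitz constant times `‖v‖` and converge almost everywhere by
  -- Rademacher, so dominated convergence applies.
  let h : ℕ → ℝ := fun n => 1 / ((n : ℝ) + 1)
  have hpos : ∀ n, 0 < h n := fun n => Nat.one_div_pos_of_nat
  have hmp : ∀ n, MeasurePreserving (· + proj d (h n • v)) (cylVol d T) (cylVol d T) := by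
    intro n
    have := (measurePreserving_add_right (volume : Measure (Torus d × ℝ))
      (proj d (h n • v))).restrict_preimage (measurableSet_cyl T)
    have hpre : (· + proj d (h n • v)) ⁻¹' cyl d T = cyl d T := by
      ext z
      simp [cyl, hv]
    rwa [hpre] at this
  have hz : ∀ n, ∫ z, (h n)⁻¹ * (φ (z + proj d (h n • v)) - φ z) ∂(cylVol d T) = 0 := by
    intro n
    have e : ∫ z, φ (z + proj d (h n • v)) ∂(cylVol d T) = ∫ z, φ z ∂(cylVol d T) :=
      (hmp n).integral_comp (MeasurableEquiv.addRight _).measurableEmbedding φ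
    have e2 := integral_sub ((hmp n).integrable_comp_of_integrable hint) hint
    simp only [Function.comp_apply] at e2
    rw [integral_const_mul, e2, e, sub_self, mul_zero]
  have hlim : Tendsto (fun n => ∫ z, (h n)⁻¹ * (φ (z + proj d (h n • v)) - φ z) ∂(cylVol d T))
      atTop (𝓝 (∫ z, dirDeriv v φ z ∂(cylVol d T))) := by
    refine tendsto_integral_of_dominated_convergence (fun _ => K * ‖v‖) (fun n => ?_)
      (integrable_const _) (fun n => ae_of_all _ fun z => ?_) ?_
    · exact (by fun_prop : Continuous fun z =>
        (h n)⁻¹ * (φ (z + proj d (h n • v)) - φ z)).aestronglyMeasurable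
    · have := hφ.dist_le_mul (sect z + h n • v) (sect z)
      simp only [Function.comp, map_add, proj_sect, dist_eq_norm,
        add_sub_cancel_left, norm_smul, Real.norm_of_nonneg (hpos n).le] at this
      rw [norm_mul, norm_inv, Real.norm_of_nonneg (hpos n).le, inv_mul_le_iff₀ (hpos n)]
      linarith
    · filter_upwards [ae_cylVol_of_ae (ae_differentiableAt_sect hφ)] with z hz
      rw [dirDeriv_eq_fderiv hz]
      have := (hz.hasFDerivAt.hasLineDerivAt v).tendsto_slope_zero
      have h2 := this.comp (f := h) (x := atTop) (tendsto_nhdsWithin_iff.2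
        ⟨tendsto_one_div_add_atTop_nhds_zero_nat,
          Eventually.of_forall fun n => (hpos n).ne'⟩)
      refine h2.congr fun n => ?_
      simp
  simp only [hz] at hlim
  exact tendsto_nhds_unique hlim tendsto_const_nhds

theorem integral_dx_of_lipschitz {T : ℝ} (α : Fin d) {φ : Torus d × ℝ → ℝ} {K : ℝ≥0}
    (hφ : LipschitzWith K (φ ∘ proj d)) : ∫ z, dx α φ z ∂(cylVol d T) = 0 := by
  simp only [dx_eq]
  exact integral_dirDeriv_of_snd_eq_zero rfl hφ

theorem integrable_dirDeriv {T : ℝ} {v : Cover d} {φ : Torus d × ℝ → ℝ} {K : ℝ≥0}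
    (hφ : LipschitzWith K (φ ∘ proj d)) : Integrable (dirDeriv v φ) (cylVol d T) :=
  (integrable_const (K * ‖v‖)).mono' (measurable_dirDeriv hφ.continuous).aestronglyMeasurable
    (ae_of_all _ (norm_dirDeriv_le hφ))

/-- On each vertical line a Lipschitz function is absolutely continuous, so Fubini reduces this to
the fundamental theorem of calculus. -/
theorem integral_dt_of_lipschitz {T : ℝ} (hT : 0 ≤ T) {φ : Torus d × ℝ → ℝ} {K : ℝ≥0}
    (hφ : LipschitzWith K (φ ∘ proj d)) :
    ∫ z, dt φ z ∂(cylVol d T) = (∫ x, φ (x, T)) - ∫ x, φ (x, 0) := by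
  have hc : Continuous φ := continuous_of_comp_proj hφ.continuous
  have hi : ∀ t, Integrable (fun x : Torus d => φ (x, t)) := fun t => by
    have : Continuous fun x : Torus d => φ (x, t) := by fun_prop
    simpa using this.continuousOn.integrableOn_compact (μ := volume) isCompact_univ
  rw [← integral_sub (hi T) (hi 0)]
  have hint : Integrable (dt φ) (cylVol d T) := by
    simp only [funext (dt_eq φ)]
    exact integrable_dirDeriv hφ
  rw [cylVol_eq_prod] at hint ⊢
  rw [integral_prod _ hint]
  refine integral_congr_ae (ae_of_all _ fun x => ?_)
  have hl : LipschitzWith K fun t : ℝ => φ (x, t) := by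
    refine LipschitzWith.of_dist_le_mul fun s t => ?_
    have := hφ.dist_le_mul ((sect (x, 0)).1, s) ((sect (x, 0)).1, t)
    have e : ∀ s : ℝ, proj d ((sect (x, 0)).1, s) = (x, s) := fun s => by
      have := congrArg Prod.fst (proj_sect (x, (0 : ℝ)))
      exact Prod.ext this rfl
    simpa [e, Prod.dist_eq] using this
  have := (hl.lipschitzOnWith (s := Set.uIcc 0 T)).absolutelyContinuousOnInterval.integral_deriv_eq_sub
  rw [intervalIntegral.integral_of_le hT, ← restrict_Ico_eq_restrict_Ioc] at this
  exact this

end Torus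

/-! ### Smooth bumps and the fundamental lemma of the calculus of variations. -/

section Tests

variable {d : ℕ}

/-- For the representative `θ` with `|θ| ≤ π` one has `cos θ ≤ 1 - (2/π²) θ²`. Cosine, smooth and
periodic, thus detects closeness to zero on the circle, which gives bump functions with smooth
lifts. -/
theorem norm_lt_of_one_sub_lt_cos {δ : ℝ} (hδ : 0 < δ) {x : ℝ}
    (h : 1 - 2 / Real.pi ^ 2 * δ ^ 2 < Real.cos x) : ‖(x : AddCircle (2 * Real.pi))‖ < δ := by
  have h1 := AddCircle.norm_eq (2 * Real.pi) (x := x)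
  have h2 := AddCircle.norm_le_half_period (2 * Real.pi) (x := (x : AddCircle (2 * Real.pi)))
    (by positivity)
  rw [abs_of_pos (by positivity : 0 < 2 * Real.pi), mul_div_cancel_left₀ _ two_ne_zero] at h2
  set θ := x - round ((2 * Real.pi)⁻¹ * x) * (2 * Real.pi) with hθ
  have h3 : Real.cos θ = Real.cos x := by rw [hθ, Real.cos_sub_int_mul_two_pi]
  rw [h1] at h2 ⊢
  have h4 := Real.cos_le_one_sub_mul_cos_sq h2
  have h5 : 2 / Real.pi ^ 2 * θ ^ 2 < 2 / Real.pi ^ 2 * δ ^ 2 := by linarith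
  exact abs_lt_of_sq_lt_sq (lt_of_mul_lt_mul_left h5 (by positivity)) hδ.le

/-- Smooth bump functions on `𝕋ᵈ × ℝ`. -/
theorem exists_bump (z₀ : Torus d × ℝ) {N : Set (Torus d × ℝ)} (hN : N ∈ 𝓝 z₀) :
    ∃ φ : Torus d × ℝ → ℝ, ContDiff ℝ ∞ (φ ∘ proj d) ∧ (∀ z, 0 ≤ φ z) ∧ (∀ z, φ z ≤ 1) ∧
      (∀ z, φ z ≠ 0 → z ∈ N) ∧ 0 < φ z₀ := by
  obtain ⟨δ, hδ, hball⟩ := Metric.mem_nhds_iff.1 hN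
  let c : AddCircle (2 * Real.pi) → ℝ := Real.cos_periodic.lift
  have hc : ∀ x : ℝ, c x = Real.cos x := fun x => Real.cos_periodic.lift_coe x
  let b : AddCircle (2 * Real.pi) → ℝ := fun x =>
    Real.smoothTransition (c x - (1 - 2 / Real.pi ^ 2 * δ ^ 2))
  let φ : Torus d × ℝ → ℝ := fun z =>
    (∏ i, b (z.1 i - z₀.1 i)) * Real.smoothTransition (1 - ((z.2 - z₀.2) / δ) ^ 2)
  have hb : ∀ x, b x ≠ 0 → ‖x‖ < δ := by
    intro x
    induction x using QuotientAddGroup.induction_on with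
    | H x =>
      intro h
      refine norm_lt_of_one_sub_lt_cos hδ ?_
      by_contra! h'
      refine h (Real.smoothTransition.zero_of_nonpos ?_)
      rw [hc]
      linarith
  have hb0 : 0 < b 0 := by
    refine Real.smoothTransition.pos_of_pos ?_
    have : c 0 = 1 := by
      have := hc 0
      rwa [Real.cos_zero] at this
    rw [this]
    have : 0 < 2 / Real.pi ^ 2 * δ ^ 2 := by positivity
    linarith
  have hbn : ∀ x, 0 ≤ b x := fun x => Real.smoothTransition.nonneg _
  have hb1 : ∀ x, b x ≤ 1 := fun x => Real.smoothTransition.le_one _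
  refine ⟨φ, ?_, fun z => ?_, fun z => ?_, fun z hz => hball ?_, ?_⟩
  · have e : φ ∘ proj d = fun y : Cover d =>
        (∏ i, Real.smoothTransition (Real.cos (y.1 i - (sect z₀).1 i) -
          (1 - 2 / Real.pi ^ 2 * δ ^ 2))) *
          Real.smoothTransition (1 - ((y.2 - z₀.2) / δ) ^ 2) := by
      funext y
      have e0 : ∀ i, z₀.1 i = ((sect z₀).1 i : AddCircle (2 * Real.pi)) := fun i =>
        (congrFun (congrArg Prod.fst (proj_sect z₀)) i).symm
      simp only [Function.comp, φ, b, proj_apply, e0, ← AddCircle.coe_sub, hc]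
    rw [e]
    refine ContDiff.mul (contDiff_prod fun i _ => ?_) ?_
    · refine Real.smoothTransition.contDiff.comp ((Real.contDiff_cos.comp ?_).sub contDiff_const)
      fun_prop
    · refine Real.smoothTransition.contDiff.comp ?_
      fun_prop
  · exact mul_nonneg (Finset.prod_nonneg fun i _ => hbn _) (Real.smoothTransition.nonneg _)
  · exact mul_le_one₀ (Finset.prod_le_one (fun i _ => hbn _) fun i _ => hb1 _)
      (Real.smoothTransition.nonneg _) (Real.smoothTransition.le_one _)
  · obtain ⟨h1, h2⟩ := mul_ne_zero_iff.1 hz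
    rw [Metric.mem_ball, Prod.dist_eq, max_lt_iff]
    constructor
    · rw [dist_pi_lt_iff hδ]
      intro i
      rw [dist_eq_norm]
      exact hb _ (Finset.prod_ne_zero_iff.1 h1 i (Finset.mem_univ i))
    · rw [Real.dist_eq]
      have h3 : 0 < 1 - ((z.2 - z₀.2) / δ) ^ 2 := by
        by_contra! h
        exact h2 (Real.smoothTransition.zero_of_nonpos h)
      have h4 : |(z.2 - z₀.2) / δ| < 1 := (sq_lt_one_iff_abs_lt_one _).1 (by linarith)
      rwa [abs_div, abs_of_pos hδ, div_lt_one hδ] at h4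
  · refine mul_pos (Finset.prod_pos fun i _ => ?_) (Real.smoothTransition.pos_of_pos ?_)
    · simpa using hb0
    · simp

theorem IsInteriorTest.continuous {T : ℝ} {φ : Torus d × ℝ → ℝ} (h : IsInteriorTest T φ) :
    Continuous φ := continuous_of_comp_proj h.1.continuous

theorem IsInteriorTest.hasCompactSupport {T : ℝ} {φ : Torus d × ℝ → ℝ} (h : IsInteriorTest T φ) :
    HasCompactSupport φ := by
  obtain ⟨_, σ, τ, hσ, hτ, h0⟩ := h
  refine HasCompactSupport.intro (isCompact_univ.prod (isCompact_Icc (a := σ) (b := τ)))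
    fun z hz => h0 z.1 z.2 ?_
  by_contra! h
  exact hz ⟨trivial, h.1.le, h.2.le⟩

theorem fderiv_comp_proj_eq {W : Type*} [NormedAddCommGroup W] [NormedSpace ℝ W]
    (φ : Torus d × ℝ → W) {y y' : Cover d} (h : proj d y = proj d y') :
    fderiv ℝ (φ ∘ proj d) y = fderiv ℝ (φ ∘ proj d) y' := by
  have hc : proj d (y' - y) = 0 := by rw [map_sub, h, sub_self]
  have : (fun x => (φ ∘ proj d) (x + (y' - y))) = φ ∘ proj d := by
    funext x
    simp [hc, map_add]
  have h2 := fderiv_comp_add_right (𝕜 := ℝ) (f := φ ∘ proj d) (x := y) (y' - y)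
  rw [this] at h2
  rw [h2, add_sub_cancel]

/-- The derivative of the lift is periodic, so it descends to a continuous function, bounded on the
compact time slab where it can be nonzero. -/
theorem IsInteriorTest.exists_lipschitzWith {T : ℝ} {φ : Torus d × ℝ → ℝ}
    (h : IsInteriorTest T φ) : ∃ K : ℝ≥0, LipschitzWith K (φ ∘ proj d) := by
  have hs : ContDiff ℝ ∞ (φ ∘ proj d) := h.1
  obtain ⟨_, σ, τ, hσ, hτ, h0⟩ := h
  have hfc : Continuous fun z : Torus d × ℝ => fderiv ℝ (φ ∘ proj d) (sect z) := by
    refine continuous_of_comp_proj ?_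
    have : (fun z : Torus d × ℝ => fderiv ℝ (φ ∘ proj d) (sect z)) ∘ proj d =
        fderiv ℝ (φ ∘ proj d) := by
      funext y
      exact fderiv_comp_proj_eq φ (proj_sect _)
    rw [this]
    exact hs.continuous_fderiv (by simp)
  obtain ⟨C, hC⟩ := ((isCompact_univ (X := Torus d)).prod
    (isCompact_Icc (a := σ) (b := τ))).exists_bound_of_continuousOn hfc.continuousOn
  refine ⟨(max C 0).toNNReal, lipschitzWith_of_nnnorm_fderiv_le (𝕜 := ℝ)
    (hs.differentiable (by simp)) fun y => ?_⟩
  rw [← NNReal.coe_le_coe, coe_nnnorm, Real.coe_toNNReal _ (le_max_right _ _)]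
  by_cases hy : y.2 ∈ Set.Icc σ τ
  · have := hC (proj d y) ⟨trivial, hy⟩
    rw [fderiv_comp_proj_eq φ (proj_sect (proj d y))] at this
    exact this.trans (le_max_left _ _)
  · have hopen : IsOpen {y : Cover d | y.2 ∉ Set.Icc σ τ} :=
      (isClosed_Icc.preimage continuous_snd).isOpen_compl
    have hev : φ ∘ proj d =ᶠ[𝓝 y] fun _ => 0 := by
      filter_upwards [hopen.mem_nhds hy] with y' hy'
      refine h0 _ _ ?_
      by_contra! h
      exact hy' ⟨h.1.le, h.2.le⟩
    rw [hev.fderiv_eq]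
    simp

theorem exists_lipschitzWith_comp {X W W' : Type*} [PseudoMetricSpace X]
    [NormedAddCommGroup W] [NormedSpace ℝ W]
    [FiniteDimensional ℝ W] [NormedAddCommGroup W'] [NormedSpace ℝ W'] {g : W → W'}
    (hg : ContDiff ℝ 1 g) {f : X → W} {K : ℝ≥0} (hf : LipschitzWith K f) {R : ℝ}
    (hR : ∀ x, ‖f x‖ ≤ R) : ∃ K' : ℝ≥0, LipschitzWith K' (g ∘ f) := by
  obtain ⟨L, hL⟩ := exists_lipschitzOnWith_closedBall hg R
  refine ⟨L * K, lipschitzOnWith_univ.1 (hL.comp hf.lipschitzOnWith fun x _ => ?_)⟩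
  simpa using hR x

/-- An integrable function on `Q_T` that is orthogonal to all test functions vanishes. -/
theorem ae_eq_zero_of_forall_interiorTest {T : ℝ} {w : Torus d × ℝ → ℝ}
    (hw : Integrable w (cylVol d T))
    (h : ∀ φ, IsInteriorTest T φ → ∫ z, φ z * w z ∂(cylVol d T) = 0) :
    ∀ᵐ z ∂(cylVol d T), w z = 0 := by
  have key : ∀ σ τ : ℝ, 0 < σ → τ < T → ∀ᵐ z ∂(cylVol d T), z.2 ∈ Set.Ioo σ τ → w z = 0 := by
    intro σ τ hσ hτ
    -- With this time cutoff, `g χ` is an interior test function for every bounded `g` with smooth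
    -- lift.
    let χ : ℝ → ℝ := fun t => Real.smoothTransition (t - σ) * Real.smoothTransition (τ - t)
    have hχ : ContDiff ℝ ∞ χ :=
      (Real.smoothTransition.contDiff.comp (contDiff_id.sub contDiff_const)).mul
        (Real.smoothTransition.contDiff.comp (contDiff_const.sub contDiff_id))
    have hχ1 : ∀ t, ‖χ t‖ ≤ 1 := fun t => by
      rw [Real.norm_of_nonneg (mul_nonneg (Real.smoothTransition.nonneg _)
        (Real.smoothTransition.nonneg _))]
      exact mul_le_one₀ (Real.smoothTransition.le_one _) (Real.smoothTransition.nonneg _)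
        (Real.smoothTransition.le_one _)
    let w' : Torus d × ℝ → ℝ := fun z => χ z.2 * w z
    have hw' : Integrable w' (cylVol d T) :=
      hw.bdd_mul (hχ.continuous.comp continuous_snd).aestronglyMeasurable
        (ae_of_all _ fun z => hχ1 z.2)
    -- The positive and negative parts of `χ w` are viewed as finite measures. Functions with smooth
    -- lift form a star subalgebra separating points, hence determine finite measures on a Polish
    -- space; so `P = P'` and the two densities agree.
    let P := (cylVol d T).withDensity fun z => ENNReal.ofReal (w' z)
    let P' := (cylVol d T).withDensity fun z => ENNReal.ofReal (-w' z)
    have : IsFiniteMeasure P := isFiniteMeasure_withDensity_ofReal hw'.2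
    have : IsFiniteMeasure P' := isFiniteMeasure_withDensity_ofReal hw'.neg.2
    have hm : AEMeasurable (fun z => ENNReal.ofReal (w' z)) (cylVol d T) :=
      hw'.1.aemeasurable.ennreal_ofReal
    have hm' : AEMeasurable (fun z => ENNReal.ofReal (-w' z)) (cylVol d T) :=
      hw'.1.aemeasurable.neg.ennreal_ofReal
    let S : StarSubalgebra ℝ (BoundedContinuousFunction (Torus d × ℝ) ℝ) :=
      { carrier := {g | ContDiff ℝ ∞ (g ∘ proj d)}
        mul_mem' := fun {a b} (ha : ContDiff ℝ ∞ (a ∘ proj d)) (hb : ContDiff ℝ ∞ (b ∘ proj d)) =>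
          ha.mul hb
        add_mem' := fun {a b} (ha : ContDiff ℝ ∞ (a ∘ proj d)) (hb : ContDiff ℝ ∞ (b ∘ proj d)) =>
          ha.add hb
        algebraMap_mem' := fun r => (contDiff_const : ContDiff ℝ ∞ fun _ : Cover d => r)
        star_mem' := fun {a} ha => ha }
    have hPP : P = P' := by
      refine ext_of_forall_mem_subalgebra_integral_eq_of_polish (𝕜 := ℝ) (A := S) ?_ ?_
      · intro z z' hne
        obtain ⟨φ, hφ, h0, h1, hN, hpos⟩ := exists_bump z (isOpen_ne.mem_nhds hne)
        let g : BoundedContinuousFunction (Torus d × ℝ) ℝ :=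
          BoundedContinuousFunction.ofNormedAddCommGroup φ
            (continuous_of_comp_proj hφ.continuous) 1 fun z => by
              rw [Real.norm_of_nonneg (h0 z)]
              exact h1 z
        refine ⟨g, ⟨_, ⟨g, hφ, rfl⟩, rfl⟩, ?_⟩
        have : φ z' = 0 := by
          by_contra h
          exact hN z' h rfl
        change φ z ≠ φ z'
        rw [this]
        exact hpos.ne'
      · intro g hg
        rw [integral_withDensity_eq_integral_toReal_smul₀ hm (ae_of_all _ fun _ => by simp),
          integral_withDensity_eq_integral_toReal_smul₀ hm' (ae_of_all _ fun _ => by simp),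
          ← sub_eq_zero]
        have hgb : ∀ z, ‖g z‖ ≤ ‖g‖ := g.norm_coe_le_norm
        have i1 : Integrable (fun z => (ENNReal.ofReal (w' z)).toReal • g z) (cylVol d T) := by
          simp only [ENNReal.toReal_ofReal', smul_eq_mul]
          exact hw'.pos_part.mul_bdd g.continuous.aestronglyMeasurable (ae_of_all _ hgb)
        have i2 : Integrable (fun z => (ENNReal.ofReal (-w' z)).toReal • g z) (cylVol d T) := by
          simp only [ENNReal.toReal_ofReal', smul_eq_mul]
          exact hw'.neg_part.mul_bdd g.continuous.aestronglyMeasurable (ae_of_all _ hgb)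
        rw [← integral_sub i1 i2, ← h (fun z => g z * χ z.2) ?_]
        · refine integral_congr_ae (ae_of_all _ fun z => ?_)
          simp only [ENNReal.toReal_ofReal', smul_eq_mul, ← sub_mul]
          have : max (w' z) 0 - max (-w' z) 0 = w' z := max_zero_sub_max_neg_zero_eq_self _
          rw [this]
          simp only [w']
          ring
        · refine ⟨ContDiff.mul hg (hχ.comp contDiff_snd), σ, τ, hσ, hτ, fun x t ht => ?_⟩
          rcases ht with ht | ht
          · simp [χ, Real.smoothTransition.zero_of_nonpos (sub_nonpos.2 ht)]
          · simp [χ, Real.smoothTransition.zero_of_nonpos (sub_nonpos.2 ht)]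
    have := (withDensity_eq_iff hm hm' hw'.lintegral_lt_top.ne).1 hPP
    filter_upwards [this] with z hz ht
    have hw0 : w' z = 0 := by
      rcases lt_trichotomy (w' z) 0 with h1 | h1 | h1
      · rw [ENNReal.ofReal_of_nonpos h1.le] at hz
        exact absurd hz.symm (by simpa using h1)
      · exact h1
      · rw [ENNReal.ofReal_of_nonpos (neg_nonpos.2 h1.le)] at hz
        exact absurd hz (by simpa using h1)
    refine (mul_eq_zero.1 hw0).resolve_left (mul_pos ?_ ?_).ne'
    · exact Real.smoothTransition.pos_of_pos (sub_pos.2 ht.1)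
    · exact Real.smoothTransition.pos_of_pos (sub_pos.2 ht.2)
  have hall : ∀ᵐ z ∂(cylVol d T), ∀ k : ℕ,
      z.2 ∈ Set.Ioo (1 / ((k : ℝ) + 1)) (T - 1 / ((k : ℝ) + 1)) → w z = 0 :=
    ae_all_iff.2 fun k => key _ _ Nat.one_div_pos_of_nat (sub_lt_self _ Nat.one_div_pos_of_nat)
  filter_upwards [hall, ae_cylVol_mem_Ioo T] with z hz ht
  obtain ⟨k, hk⟩ := exists_nat_one_div_lt (lt_min ht.1 (sub_pos.2 ht.2))
  exact hz k ⟨hk.trans_le (min_le_left _ _), by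
    have := hk.trans_le (min_le_right _ _)
    linarith⟩

end Tests

/-! ### Bounded weak derivatives imply Lipschitz bounds. -/

section Weak

variable {d : ℕ}

theorem hasDerivAt_translate {φ : Torus d × ℝ → ℝ} (hφ : ContDiff ℝ 1 (φ ∘ proj d)) (v : Cover d)
    (z : Torus d × ℝ) (s : ℝ) :
    HasDerivAt (fun s : ℝ => φ (z - proj d (s • v)))
      (-dirDeriv v (fun z => φ (z - proj d (s • v))) z) s := by
  have h1 : HasDerivAt (fun s : ℝ => sect z - s • v) (-v) s := by
    simpa using ((hasDerivAt_id s).smul_const v).const_sub (sect z)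
  have h2 := (hφ.differentiable one_ne_zero (sect z - s • v)).hasFDerivAt.comp_hasDerivAt s h1
  have e : (fun s : ℝ => φ (z - proj d (s • v))) = (φ ∘ proj d) ∘ fun s : ℝ => sect z - s • v := by
    funext s
    simp [map_sub]
  rw [e]
  refine h2.congr_deriv ?_
  have e2 : (fun z => φ (z - proj d (s • v))) ∘ proj d =
      fun y => (φ ∘ proj d) (y - s • v) := by
    funext y
    simp [map_sub]
  rw [dirDeriv, e2, map_neg, neg_inj, DifferentiableAt.lineDeriv_eq_fderiv, fderiv_comp_sub]
  exact (hφ.differentiable one_ne_zero _).comp _ (by fun_prop)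

theorem integrable_cylVol_of_continuous {W : Type*} [NormedAddCommGroup W]
    {f : Torus d × ℝ → W} (hf : Continuous f) (T : ℝ) : Integrable f (cylVol d T) := by
  have h1 : IntegrableOn f (Set.univ ×ˢ Set.Icc 0 T) :=
    hf.continuousOn.integrableOn_compact (isCompact_univ.prod isCompact_Icc)
  exact h1.mono_set (Set.prod_mono_right Set.Ico_subset_Icc_self)

theorem setIntegral_cyl_eq_of_interior {W : Type*} [NormedAddCommGroup W] [NormedSpace ℝ W]
    {T : ℝ} {φ : Torus d × ℝ → ℝ} (hφ : IsInteriorTest T φ) (f : Torus d × ℝ → W) :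
    ∫ z, φ z • f z ∂(cylVol d T) = ∫ z, φ z • f z := by
  refine setIntegral_eq_integral_of_forall_compl_eq_zero fun z hz => ?_
  obtain ⟨_, σ, τ, hσ, hτ, h0⟩ := hφ
  rw [show φ z = 0 from h0 z.1 z.2 ?_, zero_smul]
  by_contra! h
  exact hz ⟨trivial, (hσ.trans h.1).le, h.2.trans hτ⟩

variable {W : Type*} [NormedAddCommGroup W] [NormedSpace ℝ W]

/-- The translation is put on the test function. By the weak derivative identity, `s ↦ ∫ φ(z - s v)
f` has derivative `∫ φ(z - s v) g`, of norm at most `M ∫ φ`, and the mean value inequality concludes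
without regularising `f`. -/
theorem norm_integral_translate_sub_le {T : ℝ} {v : Cover d}
    {f g : Torus d × ℝ → W} (hf : Continuous f)
    (hw : ∀ φ, IsInteriorTest T φ →
      ∫ z, dirDeriv v φ z • f z ∂(cylVol d T) = -∫ z, φ z • g z ∂(cylVol d T))
    {M : ℝ} (hM : ∀ᵐ z ∂(cylVol d T), ‖g z‖ ≤ M) (hM0 : 0 ≤ M) {φ : Torus d × ℝ → ℝ}
    (hφ0 : ∀ z, 0 ≤ φ z) {h : ℝ} (hh : 0 ≤ h)
    (hφ : ∀ s ∈ Set.Icc 0 h, IsInteriorTest T fun z => φ (z - proj d (s • v))) :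
    ‖∫ z, φ (z - proj d (h • v)) • f z ∂(cylVol d T) - ∫ z, φ z • f z ∂(cylVol d T)‖ ≤
      M * (∫ z, φ z) * h := by
  have hφi : IsInteriorTest T φ := by simpa using hφ 0 ⟨le_rfl, hh⟩
  have hφ1 : ContDiff ℝ 1 (φ ∘ proj d) := hφi.1.of_le (by exact_mod_cast le_top)
  have hφc := hφi.continuous
  obtain ⟨K, hK⟩ := hφi.exists_lipschitzWith
  have hKs : ∀ s : ℝ, LipschitzWith K ((fun z => φ (z - proj d (s • v))) ∘ proj d) := by
    intro s
    refine LipschitzWith.of_dist_le_mul fun y y' => ?_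
    simpa [map_sub] using hK.dist_le_mul (y - s • v) (y' - s • v)
  have hfi := integrable_cylVol_of_continuous hf T
  have hder : ∀ s ∈ Set.Icc 0 h, HasDerivAt
      (fun s : ℝ => ∫ z, φ (z - proj d (s • v)) • f z ∂(cylVol d T))
      (∫ z, φ (z - proj d (s • v)) • g z ∂(cylVol d T)) s := by
    intro s hs
    have h1 := hw _ (hφ s hs)
    have h2 : ∫ z, φ (z - proj d (s • v)) • g z ∂(cylVol d T) =
        ∫ z, (-dirDeriv v (fun z => φ (z - proj d (s • v))) z) • f z ∂(cylVol d T) := by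
      simp only [neg_smul]
      rw [integral_neg, h1, neg_neg]
    rw [h2]
    refine (hasDerivAt_integral_of_dominated_loc_of_deriv_le (𝕜 := ℝ) (s := Set.univ)
      (F' := fun s z => (-dirDeriv v (fun z => φ (z - proj d (s • v))) z) • f z)
      (bound := fun z => K * ‖v‖ * ‖f z‖) univ_mem (Eventually.of_forall fun s => ?_) ?_ ?_
      (ae_of_all _ fun z s _ => ?_) (hfi.norm.const_mul _) (ae_of_all _ fun z s _ => ?_)).2
    · exact ((by fun_prop : Continuous fun z => φ (z - proj d (s • v))).smul hf).aestronglyMeasurable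
    · exact integrable_cylVol_of_continuous
        ((by fun_prop : Continuous fun z => φ (z - proj d (s • v))).smul hf) T
    · exact (measurable_dirDeriv (hKs s).continuous).neg.aestronglyMeasurable.smul
        hf.aestronglyMeasurable
    · rw [norm_smul, norm_neg]
      gcongr
      exact norm_dirDeriv_le (hKs s) z
    · exact (hasDerivAt_translate hφ1 v z s).smul_const (f z)
  have hbound : ∀ s ∈ Set.Ico 0 h,
      ‖∫ z, φ (z - proj d (s • v)) • g z ∂(cylVol d T)‖ ≤ M * ∫ z, φ z := by
    intro s hs
    have hs' := hφ s ⟨hs.1, hs.2.le⟩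
    have hi : Integrable fun z => φ (z - proj d (s • v)) :=
      hs'.continuous.integrable_of_hasCompactSupport hs'.hasCompactSupport
    calc _ ≤ ∫ z, φ (z - proj d (s • v)) * M ∂(cylVol d T) := by
          refine norm_integral_le_of_norm_le (hi.restrict.mul_const M) ?_
          filter_upwards [hM] with z hz
          rw [norm_smul, Real.norm_of_nonneg (hφ0 _)]
          exact mul_le_mul_of_nonneg_left hz (hφ0 _)
      _ = M * ∫ z, φ (z - proj d (s • v)) ∂(cylVol d T) := by
          rw [integral_mul_const, mul_comm]
      _ ≤ M * ∫ z, φ (z - proj d (s • v)) := by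
          exact mul_le_mul_of_nonneg_left
            (setIntegral_le_integral hi (ae_of_all _ fun z => hφ0 _)) hM0
      _ = _ := by rw [integral_sub_right_eq_self φ (proj d (s • v))]
  have := norm_image_sub_le_of_norm_deriv_le_segment'
    (fun s hs => (hder s hs).hasDerivWithinAt) hbound h ⟨hh, le_rfl⟩
  simpa using this

/-- A continuous function with a bounded weak directional derivative is Lipschitz in that
direction. -/
theorem norm_translate_sub_le [CompleteSpace W] {T : ℝ} {v : Cover d}
    {f g : Torus d × ℝ → W} (hf : Continuous f)
    (hw : ∀ φ, IsInteriorTest T φ →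
      ∫ z, dirDeriv v φ z • f z ∂(cylVol d T) = -∫ z, φ z • g z ∂(cylVol d T))
    {M : ℝ} (hM : ∀ᵐ z ∂(cylVol d T), ‖g z‖ ≤ M) (hM0 : 0 ≤ M) {h : ℝ} (hh : 0 ≤ h)
    {z : Torus d × ℝ} (hz : z.2 ∈ Set.Ioo 0 T) (hz' : z.2 + h * v.2 ∈ Set.Ioo 0 T) :
    ‖f (z + proj d (h • v)) - f z‖ ≤ M * h := by
  refine le_of_forall_pos_le_add fun ε hε => ?_
  let D : Torus d × ℝ → W := fun z => f (z + proj d (h • v)) - f z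
  have hD : Continuous D := by fun_prop
  -- The margin `2 * r` ensures that a bump supported within time distance `r` of `z` keeps its
  -- support in `(r, T - r)` throughout the translation.
  obtain ⟨r, hr, hr1⟩ : ∃ r > 0, ∀ s ∈ Set.Icc 0 h,
      z.2 + s * v.2 ∈ Set.Icc (2 * r) (T - 2 * r) := by
    let lo := min z.2 (z.2 + h * v.2)
    let hi := max z.2 (z.2 + h * v.2)
    have hlo : 0 < lo := lt_min hz.1 hz'.1
    have hhi : hi < T := max_lt hz.2 hz'.2
    refine ⟨min lo (T - hi) / 2, by have := lt_min hlo (sub_pos.2 hhi); positivity, fun s hs => ?_⟩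
    have h1 : lo ≤ z.2 + s * v.2 := by
      rcases le_total 0 v.2 with hv | hv
      · exact (min_le_left _ _).trans (by nlinarith [mul_nonneg hs.1 hv])
      · refine (min_le_right _ _).trans ?_
        have := mul_le_mul_of_nonpos_right hs.2 hv
        linarith
    have h2 : z.2 + s * v.2 ≤ hi := by
      rcases le_total 0 v.2 with hv | hv
      · refine le_trans ?_ (le_max_right _ _)
        have := mul_le_mul_of_nonneg_right hs.2 hv
        linarith
      · exact le_trans (by nlinarith [mul_nonpos_of_nonneg_of_nonpos hs.1 hv]) (le_max_left _ _)
    have h3 := min_le_left lo (T - hi)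
    have h4 := min_le_right lo (T - hi)
    constructor <;> linarith
  -- The bump is concentrated where the increment `D` is `ε`-close to `D z`, so the averaged
  -- estimate becomes a pointwise one up to `ε`.
  have hN : {z' | ‖D z' - D z‖ < ε} ∩ {z' | |z'.2 - z.2| < r} ∈ 𝓝 z := by
    refine inter_mem ?_ ?_
    · exact (isOpen_lt (by fun_prop) continuous_const).mem_nhds (by simpa using hε)
    · exact (isOpen_lt (by fun_prop) continuous_const).mem_nhds (by simpa using hr)
  obtain ⟨φ, hφs, h0, h1, hsupp, hpos⟩ := exists_bump z hN
  have hφi : ∀ s ∈ Set.Icc 0 h, IsInteriorTest T fun z => φ (z - proj d (s • v)) := by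
    intro s hs
    have e2 : (fun z => φ (z - proj d (s • v))) ∘ proj d =
        fun y => (φ ∘ proj d) (y - s • v) := by
      funext y
      simp [map_sub]
    refine ⟨?_, r, T - r, hr, by linarith, fun x t ht => ?_⟩
    · rw [lift_eq, e2]
      exact hφs.comp (by fun_prop)
    · by_contra hne
      have h5 : |((x, t) - proj d (s • v)).2 - z.2| < r := (hsupp _ hne).2
      rw [abs_lt] at h5
      have h6 := hr1 s hs
      simp only [Prod.snd_sub, proj_snd, Prod.smul_snd, smul_eq_mul] at h5
      rcases ht with ht | ht
      · linarith [h5.1, h6.1]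
      · linarith [h5.2, h6.2]
  have hφ0 : IsInteriorTest T φ := by simpa using hφi 0 ⟨le_rfl, hh⟩
  have hint : Integrable φ := hφ0.continuous.integrable_of_hasCompactSupport hφ0.hasCompactSupport
  have hIpos : 0 < ∫ z, φ z :=
    hφ0.continuous.integral_pos_of_hasCompactSupport_nonneg_nonzero hφ0.hasCompactSupport h0 hpos.ne'
  have key := norm_integral_translate_sub_le hf hw hM hM0 h0 hh hφi
  have hcs : ∀ {F : Torus d × ℝ → W}, Continuous F → Integrable fun z => φ z • F z := fun hF =>
    (hφ0.continuous.smul hF).integrable_of_hasCompactSupport hφ0.hasCompactSupport.smul_right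
  have e1 : ∫ z, φ (z - proj d (h • v)) • f z ∂(cylVol d T) =
      ∫ z, φ z • f (z + proj d (h • v)) := by
    rw [setIntegral_cyl_eq_of_interior (hφi h ⟨hh, le_rfl⟩),
      ← integral_add_right_eq_self _ (proj d (h • v))]
    simp
  rw [e1, setIntegral_cyl_eq_of_interior hφ0, ← integral_sub (hcs (by fun_prop)) (hcs hf)] at key
  simp only [← smul_sub] at key
  have e3 : ∫ z', φ z' • D z = (∫ z', φ z') • D z := integral_smul_const _ _
  have e4 : ‖(∫ z', φ z' • D z') - ∫ z', φ z' • D z‖ ≤ (∫ z', φ z') * ε := by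
    have e6 : (∫ z', φ z' • D z') - ∫ z', φ z' • D z = ∫ z', φ z' • (D z' - D z) := by
      simp only [smul_sub]
      exact (integral_sub (hcs hD) (hcs (F := fun _ => D z) continuous_const)).symm
    rw [e6, ← integral_mul_const]
    refine norm_integral_le_of_norm_le (hint.mul_const ε) (ae_of_all _ fun z' => ?_)
    rw [norm_smul, Real.norm_of_nonneg (h0 _)]
    by_cases hz0 : φ z' = 0
    · simp [hz0]
    · exact mul_le_mul_of_nonneg_left (hsupp z' hz0).1.le (h0 _)
  have e7 : ‖∫ z', φ z' • D z‖ ≤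
      ‖∫ z', φ z' • D z'‖ + ‖(∫ z', φ z' • D z') - ∫ z', φ z' • D z‖ := by
    have := norm_sub_le (∫ z', φ z' • D z') ((∫ z', φ z' • D z') - ∫ z', φ z' • D z)
    rwa [sub_sub_cancel] at this
  have e5 : (∫ z', φ z') * ‖D z‖ ≤ (∫ z', φ z') * (M * h + ε) := by
    calc (∫ z', φ z') * ‖D z‖ = ‖∫ z', φ z' • D z‖ := by
          rw [e3, norm_smul, Real.norm_of_nonneg hIpos.le]
      _ ≤ ‖∫ z', φ z' • D z'‖ + ‖(∫ z', φ z' • D z') - ∫ z', φ z' • D z‖ :=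
          e7
      _ ≤ M * (∫ z, φ z) * h + (∫ z', φ z') * ε := add_le_add key e4
      _ = _ := by ring
  exact le_of_mul_le_mul_left e5 hIpos

/-- Restriction of the time variable to `[0,T]`. -/
def clampTime (T : ℝ) (z : Torus d × ℝ) : Torus d × ℝ := (z.1, max 0 (min z.2 T))

theorem clampTime_mem {T : ℝ} (hT : 0 ≤ T) (z : Torus d × ℝ) :
    clampTime T z ∈ (Set.univ ×ˢ Set.Icc 0 T : Set (Torus d × ℝ)) :=
  ⟨trivial, le_max_left _ _, max_le hT (min_le_right _ _)⟩

theorem clampTime_of_mem {T : ℝ} {z : Torus d × ℝ} (hz : z.2 ∈ Set.Icc 0 T) :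
    clampTime T z = z := by
  ext <;> simp [clampTime, hz.1, hz.2]

theorem continuous_clampTime (T : ℝ) : Continuous (clampTime (d := d) T) := by
  unfold clampTime
  fun_prop

theorem abs_clamp_sub_le (T s t : ℝ) : |max 0 (min s T) - max 0 (min t T)| ≤ |s - t| := by
  have h1 := abs_max_sub_max_le_abs (min s T) (min t T) 0
  have h2 := abs_inf_sub_inf_le_abs s t T
  rw [max_comm, max_comm (min t T)] at h1
  exact h1.trans h2

end Weak

/-! ### Lipschitz representatives and identification of weak derivatives. -/

section Strong

variable {d : ℕ}

theorem HasWeakDt.congr_left {n : ℕ} {T : ℝ} {f f' g : Torus d × ℝ → State n}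
    (h : HasWeakDt T f g) (hff' : ∀ z ∈ cyl d T, f z = f' z) : HasWeakDt T f' g := by
  refine ⟨h.1, fun φ hφ => ?_⟩
  rw [← h.2 φ hφ]
  exact setIntegral_congr_fun (measurableSet_cyl T) fun z hz => by simp [hff' z hz]

theorem HasWeakDx.congr_left {n : ℕ} {T : ℝ} {α : Fin d} {f f' g : Torus d × ℝ → State n}
    (h : HasWeakDx T α f g) (hff' : ∀ z ∈ cyl d T, f z = f' z) : HasWeakDx T α f' g := by
  refine ⟨h.1, fun φ hφ => ?_⟩
  rw [← h.2 φ hφ]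
  exact setIntegral_congr_fun (measurableSet_cyl T) fun z hz => by simp [hff' z hz]

theorem clampTime_of_mem_cyl {T : ℝ} {z : Torus d × ℝ} (hz : z ∈ cyl d T) :
    clampTime T z = z :=
  clampTime_of_mem ⟨hz.2.1, hz.2.2.le⟩

theorem exists_ae_bound_of_memLp_top {n : ℕ} {T : ℝ} {g : Torus d × ℝ → State n}
    (h : MemLp g ⊤ (cylVol d T)) : ∃ M, 0 ≤ M ∧ ∀ᵐ z ∂(cylVol d T), ‖g z‖ ≤ M := by
  refine ⟨(eLpNormEssSup g (cylVol d T)).toReal, ENNReal.toReal_nonneg, ?_⟩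
  have hlt : eLpNormEssSup g (cylVol d T) < ⊤ := by simpa using h.2
  filter_upwards [ae_le_eLpNormEssSup (f := g) (μ := cylVol d T)] with z hz
  have := ENNReal.toReal_mono hlt.ne hz
  simpa using this

/-- The translation estimate covers forward steps between interior times. Symmetry gives backward
steps, and continuity reaches the endpoints, one time variable after the other. -/
theorem HasWeakDt.norm_sub_le {n : ℕ} {T : ℝ} (hT : 0 < T) {F g : Torus d × ℝ → State n}
    (hFc : Continuous F) (hg : HasWeakDt T F g) {M : ℝ} (hM0 : 0 ≤ M)
    (hM : ∀ᵐ z ∂(cylVol d T), ‖g z‖ ≤ M) (x : Torus d) {s t : ℝ} (hs : s ∈ Set.Icc 0 T)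
    (ht : t ∈ Set.Icc 0 T) : ‖F (x, t) - F (x, s)‖ ≤ M * |t - s| := by
  have key : ∀ s ∈ Set.Ioo 0 T, ∀ t ∈ Set.Ioo 0 T, s ≤ t →
      ‖F (x, t) - F (x, s)‖ ≤ M * (t - s) := by
    intro s hs t ht hst
    have := norm_translate_sub_le (v := timeDir d) hFc
      (fun φ hφ => by simpa only [dt_eq] using hg.2 φ hφ) hM hM0 (sub_nonneg.2 hst)
      (z := (x, s)) hs (by simpa [timeDir] using ht)
    simpa [proj_timeDir] using this
  have hIoo : ∀ s ∈ Set.Ioo 0 T, ∀ t ∈ Set.Ioo 0 T, ‖F (x, t) - F (x, s)‖ ≤ M * |t - s| := by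
    intro s hs t ht
    rcases le_total s t with hst | hst
    · rw [abs_of_nonneg (sub_nonneg.2 hst)]
      exact key s hs t ht hst
    · rw [norm_sub_rev, abs_sub_comm, abs_of_nonneg (sub_nonneg.2 hst)]
      exact key t ht s hs hst
  have hIcc : ∀ s ∈ Set.Ioo 0 T, ∀ t ∈ Set.Icc 0 T, ‖F (x, t) - F (x, s)‖ ≤ M * |t - s| := by
    intro s hs t ht
    have hcl : IsClosed {t : ℝ | ‖F (x, t) - F (x, s)‖ ≤ M * |t - s|} :=
      isClosed_le (by fun_prop) (by fun_prop)
    have hmem : t ∈ closure (Set.Ioo 0 T) := by rwa [closure_Ioo hT.ne]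
    exact closure_minimal (fun t ht => hIoo s hs t ht) hcl hmem
  have hcl : IsClosed {s : ℝ | ‖F (x, t) - F (x, s)‖ ≤ M * |t - s|} :=
    isClosed_le (by fun_prop) (by fun_prop)
  have hmem : s ∈ closure (Set.Ioo 0 T) := by rwa [closure_Ioo hT.ne]
  exact closure_minimal (fun s hs => hIcc s hs t ht) hcl hmem

theorem HasWeakDx.norm_sub_le {n : ℕ} {T : ℝ} (hT : 0 < T) {α : Fin d}
    {F g : Torus d × ℝ → State n}
    (hFc : Continuous F) (hg : HasWeakDx T α F g) {M : ℝ} (hM0 : 0 ≤ M)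
    (hM : ∀ᵐ z ∂(cylVol d T), ‖g z‖ ≤ M) (x : Torus d) {t : ℝ} (ht : t ∈ Set.Icc 0 T) (h : ℝ) :
    ‖F (x + Pi.single α (h : AddCircle (2 * Real.pi)), t) - F (x, t)‖ ≤ M * |h| := by
  have key : ∀ x, ∀ t ∈ Set.Ioo 0 T, ∀ h : ℝ, 0 ≤ h →
      ‖F (x + Pi.single α (h : AddCircle (2 * Real.pi)), t) - F (x, t)‖ ≤ M * h := by
    intro x t ht h hh
    have := norm_translate_sub_le (v := spaceDir α) hFc
      (fun φ hφ => by simpa only [dx_eq] using hg.2 φ hφ) hM hM0 hh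
      (z := (x, t)) ht (by simpa [spaceDir] using ht)
    simpa [proj_spaceDir] using this
  have hIoo : ∀ t ∈ Set.Ioo 0 T,
      ‖F (x + Pi.single α (h : AddCircle (2 * Real.pi)), t) - F (x, t)‖ ≤ M * |h| := by
    intro t ht
    rcases le_total 0 h with hh | hh
    · rw [abs_of_nonneg hh]
      exact key x t ht h hh
    · rw [norm_sub_rev, abs_of_nonpos hh]
      have := key (x + Pi.single α (h : AddCircle (2 * Real.pi))) t ht (-h) (neg_nonneg.2 hh)
      rwa [add_assoc, ← Pi.single_add, ← AddCircle.coe_add, add_neg_cancel, AddCircle.coe_zero,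
        Pi.single_zero, add_zero] at this
  have hcl : IsClosed {t : ℝ |
      ‖F (x + Pi.single α (h : AddCircle (2 * Real.pi)), t) - F (x, t)‖ ≤ M * |h|} :=
    isClosed_le (by fun_prop) (by fun_prop)
  have hmem : t ∈ closure (Set.Ioo 0 T) := by rwa [closure_Ioo hT.ne]
  exact closure_minimal hIoo hcl hmem

/-- The coordinates are changed from `y'` to `y` one at a time. -/
theorem norm_sub_le_sum_of_coordinates {n : ℕ} {t : ℝ} {F : Torus d × ℝ → State n} {M : Fin d → ℝ}
    (hM : ∀ α x, ∀ h : ℝ,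
      ‖F (x + Pi.single α (h : AddCircle (2 * Real.pi)), t) - F (x, t)‖ ≤ M α * |h|)
    (y y' : Fin d → ℝ) :
    ‖F (proj d (y, t)) - F (proj d (y', t))‖ ≤ ∑ α, M α * |y α - y' α| := by
  have key : ∀ S : Finset (Fin d),
      ‖F (proj d (fun i => if i ∈ S then y i else y' i, t)) - F (proj d (y', t))‖ ≤
        ∑ α ∈ S, M α * |y α - y' α| := by
    intro S
    induction S using Finset.induction_on with
    | empty => simp
    | insert a S ha ih =>
      have e : proj d (fun i => if i ∈ insert a S then y i else y' i, t) =
          ((proj d (fun i => if i ∈ S then y i else y' i, t)).1 +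
            Pi.single a ((y a - y' a : ℝ) : AddCircle (2 * Real.pi)), t) := by
        refine Prod.ext (funext fun i => ?_) rfl
        rcases eq_or_ne i a with rfl | hia
        · simp [proj_apply, ha]
        · simp [proj_apply, hia]
      rw [e, Finset.sum_insert ha]
      refine (norm_sub_le_norm_sub_add_norm_sub _
        (F (proj d (fun i => if i ∈ S then y i else y' i, t))) _).trans (add_le_add ?_ ih)
      exact hM a _ _
  simpa using key Finset.univ

/-- The continuous representative of a `W^{1,∞}` function, extended constantly in time, is
Lipschitz. -/
theorem MemW1Inf.exists_lipschitzWith {n : ℕ} {T : ℝ} (hT : 0 < T) {f : Torus d × ℝ → State n}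
    (h : MemW1Inf T f) : ∃ K : ℝ≥0, LipschitzWith K ((f ∘ clampTime T) ∘ proj d) := by
  have hFc : Continuous (f ∘ clampTime T) :=
    h.continuousOn.comp_continuous (continuous_clampTime T) (clampTime_mem hT.le)
  have hFf : ∀ z ∈ cyl d T, f z = (f ∘ clampTime T) z := fun z hz => by
    simp [clampTime_of_mem_cyl hz]
  -- Clamping is idempotent, so both times may be assumed to lie in `[0,T]`; clamping does not
  -- increase distances.
  have hFcl : ∀ z, (f ∘ clampTime T) z = (f ∘ clampTime T) (clampTime T z) := fun z => by
    simp [clampTime_of_mem (clampTime_mem hT.le z).2]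
  generalize f ∘ clampTime T = F at hFc hFf hFcl
  obtain ⟨gt, hgt⟩ := h.weakDt
  choose gx hgx using h.weakDx
  replace hgt := hgt.congr_left hFf
  replace hgx := fun α => (hgx α).congr_left hFf
  obtain ⟨Mt, hMt0, hMt⟩ := exists_ae_bound_of_memLp_top hgt.1
  choose Mx hMx0 hMx using fun α => exists_ae_bound_of_memLp_top (hgx α).1
  refine ⟨(Mt + ∑ α, Mx α).toNNReal, LipschitzWith.of_dist_le_mul fun y y' => ?_⟩
  have hsum : 0 ≤ ∑ α, Mx α := Finset.sum_nonneg fun α _ => hMx0 α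
  rw [Real.coe_toNNReal _ (by positivity), dist_eq_norm, Function.comp, Function.comp,
    hFcl (proj d y), hFcl (proj d y')]
  obtain ⟨t, ht⟩ : ∃ t, t = max 0 (min y.2 T) := ⟨_, rfl⟩
  obtain ⟨t', ht'⟩ : ∃ t', t' = max 0 (min y'.2 T) := ⟨_, rfl⟩
  have htm : t ∈ Set.Icc 0 T := ht ▸ (clampTime_mem hT.le (proj d y)).2
  have htm' : t' ∈ Set.Icc 0 T := ht' ▸ (clampTime_mem hT.le (proj d y')).2
  have e1 : clampTime T (proj d y) = proj d (y.1, t) := by rw [ht]; rfl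
  have e2 : clampTime T (proj d y') = proj d (y'.1, t') := by rw [ht']; rfl
  rw [e1, e2]
  have b1 : |t - t'| ≤ dist y y' := by
    rw [ht, ht']
    exact (abs_clamp_sub_le T y.2 y'.2).trans
      ((Real.dist_eq _ _).symm.le.trans (le_max_right _ _))
  have b2 : ∀ α, |y.1 α - y'.1 α| ≤ dist y y' := fun α =>
    (Real.dist_eq _ _).symm.le.trans ((dist_le_pi_dist y.1 y'.1 α).trans (le_max_left _ _))
  calc ‖F (proj d (y.1, t)) - F (proj d (y'.1, t'))‖
      ≤ ‖F (proj d (y.1, t)) - F (proj d (y.1, t'))‖ +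
        ‖F (proj d (y.1, t')) - F (proj d (y'.1, t'))‖ := norm_sub_le_norm_sub_add_norm_sub _ _ _
    _ ≤ Mt * |t - t'| + ∑ α, Mx α * |y.1 α - y'.1 α| :=
        add_le_add (hgt.norm_sub_le hT hFc hMt0 hMt _ htm' htm)
          (norm_sub_le_sum_of_coordinates
            (fun α x h => (hgx α).norm_sub_le hT hFc (hMx0 α) (hMx α) x htm' h) _ _)
    _ ≤ Mt * dist y y' + ∑ α, Mx α * dist y y' := by
        gcongr with α
        · exact hMx0 α
        · exact b2 α
    _ = _ := by rw [← Finset.sum_mul]; ring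

/-- Weak directional derivatives of Lipschitz functions are classical ones. -/
theorem dirDeriv_ae_eq_of_weak {T : ℝ} {v : Cover d}
    (hv : ∀ (ψ : Torus d × ℝ → ℝ) (K : ℝ≥0), LipschitzWith K (ψ ∘ proj d) →
      (∀ x, ψ (x, 0) = 0) → (∀ x, ψ (x, T) = 0) → ∫ z, dirDeriv v ψ z ∂(cylVol d T) = 0)
    {f g : Torus d × ℝ → ℝ} {K : ℝ≥0} (hf : LipschitzWith K (f ∘ proj d)) {R : ℝ}
    (hR : ∀ z, ‖f z‖ ≤ R)
    (hg : Integrable g (cylVol d T))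
    (hw : ∀ φ, IsInteriorTest T φ →
      ∫ z, dirDeriv v φ z * f z ∂(cylVol d T) = -∫ z, φ z * g z ∂(cylVol d T)) :
    ∀ᵐ z ∂(cylVol d T), dirDeriv v f z = g z := by
  have hfc : Continuous f := continuous_of_comp_proj hf.continuous
  have h0 := ae_eq_zero_of_forall_interiorTest ((integrable_dirDeriv hf (v := v)).sub hg) ?_
  · filter_upwards [h0] with z hz
    exact sub_eq_zero.1 hz
  intro φ hφ
  obtain ⟨L, hL⟩ := hφ.exists_lipschitzWith
  have hφc := hφ.continuous
  obtain ⟨C, hC⟩ := hφ.hasCompactSupport.exists_bound_of_continuous hφc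
  have hpair : LipschitzWith (max L K) fun y => ((φ ∘ proj d) y, (f ∘ proj d) y) :=
    hL.prodMk hf
  obtain ⟨K', hK'⟩ := exists_lipschitzWith_comp (contDiff_mul (𝕜 := ℝ) (𝔸 := ℝ) (n := 1)) hpair
    (R := max C R) fun y => max_le_max (hC _) (hR _)
  -- Integration by parts: `φ f` is Lipschitz and vanishes at both ends, so its derivative has mean
  -- zero, while the product rule holds almost everywhere. The hypothesis `hv` isolates what differs
  -- between time and space directions.
  have hψ := hv (fun z => φ z * f z) K' hK' ?_ ?_
  · have iφ : Integrable (fun z => φ z * g z) (cylVol d T) :=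
      hg.bdd_mul hφc.aestronglyMeasurable (ae_of_all _ hC)
    have iφ2 : Integrable (fun z => φ z * dirDeriv v f z) (cylVol d T) :=
      (integrable_dirDeriv hf).bdd_mul hφc.aestronglyMeasurable (ae_of_all _ hC)
    have if2 : Integrable (fun z => dirDeriv v φ z * f z) (cylVol d T) :=
      (integrable_dirDeriv hL).mul_bdd hfc.aestronglyMeasurable (ae_of_all _ hR)
    have e : ∀ᵐ z ∂(cylVol d T), dirDeriv v (fun z => φ z * f z) z =
        dirDeriv v φ z * f z + φ z * dirDeriv v f z := by
      filter_upwards [ae_cylVol_of_ae (ae_differentiableAt_sect hL),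
        ae_cylVol_of_ae (ae_differentiableAt_sect hf)] with z h1 h2
      have h3 := h1.hasFDerivAt.mul h2.hasFDerivAt
      have h4 : dirDeriv v (fun z => φ z * f z) z = _ := dirDeriv_eq_fderiv h3.differentiableAt
      rw [h4, dirDeriv_eq_fderiv h1, dirDeriv_eq_fderiv h2]
      have h5 := h3.fderiv
      have h6 : fderiv ℝ ((fun z => φ z * f z) ∘ proj d) (sect z) = _ := h5
      rw [h6]
      simp
      ring
    rw [integral_congr_ae e, integral_add if2 iφ2, hw φ hφ] at hψ
    simp only [Pi.sub_apply, mul_sub]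
    rw [integral_sub iφ2 iφ]
    linarith
  · intro x
    obtain ⟨_, σ, τ, hσ, hτ, hz⟩ := hφ
    simp [hz x 0 (Or.inl hσ.le)]
  · intro x
    obtain ⟨_, σ, τ, hσ, hτ, hz⟩ := hφ
    simp [hz x T (Or.inr hτ.le)]

theorem component_weak {n : ℕ} {T : ℝ} {v : Cover d} {f g : Torus d × ℝ → State n}
    (hf : Continuous f) (hg : MemLp g ⊤ (cylVol d T)) (i : Fin n)
    {φ : Torus d × ℝ → ℝ} (hφ : IsInteriorTest T φ)
    (hw : ∫ z, dirDeriv v φ z • f z ∂(cylVol d T) = -∫ z, φ z • g z ∂(cylVol d T)) :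
    ∫ z, dirDeriv v φ z * f z i ∂(cylVol d T) = -∫ z, φ z * g z i ∂(cylVol d T) := by
  obtain ⟨L, hL⟩ := hφ.exists_lipschitzWith
  obtain ⟨C, hC⟩ := hφ.hasCompactSupport.exists_bound_of_continuous hφ.continuous
  have i1 : Integrable (fun z => dirDeriv v φ z • f z) (cylVol d T) :=
    (integrable_cylVol_of_continuous hf T).bdd_smul (L * ‖v‖)
      (measurable_dirDeriv hL.continuous).aestronglyMeasurable (ae_of_all _ (norm_dirDeriv_le hL))
  have i2 : Integrable (fun z => φ z • g z) (cylVol d T) :=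
    (hg.integrable le_top).bdd_smul C hφ.continuous.aestronglyMeasurable (ae_of_all _ hC)
  have := congrArg (EuclideanSpace.proj (𝕜 := ℝ) i) hw
  rw [map_neg, ← ContinuousLinearMap.integral_comp_comm _ i1,
    ← ContinuousLinearMap.integral_comp_comm _ i2] at this
  simpa using this

end Strong

/-! ### Mollification and Lipschitz test functions. -/

section Mollify

open scoped Convolution

variable {d : ℕ}

/-- The mollification kernel of radius `1 / (k + 1)`. -/
noncomputable def mollifier (d k : ℕ) : ContDiffBump (0 : Cover d) where
  rIn := 1 / ((k : ℝ) + 1) / 2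
  rOut := 1 / ((k : ℝ) + 1)
  rIn_pos := half_pos Nat.one_div_pos_of_nat
  rIn_lt_rOut := half_lt_self Nat.one_div_pos_of_nat

/-- The convolution of a function on the cover with the mollification kernel. -/
noncomputable def mollify (k : ℕ) (f : Cover d → ℝ) (y : Cover d) : ℝ :=
  ∫ s, (mollifier d k).normed volume s * f (y - s)

theorem mollify_eq (k : ℕ) (f : Cover d → ℝ) :
    mollify k f = ((mollifier d k).normed volume ⋆[ContinuousLinearMap.lsmul ℝ ℝ, volume] f) := by
  funext y
  simp [mollify, convolution_def]

theorem integrable_mollifier_mul (k : ℕ) {f : Cover d → ℝ} (hf : Continuous f) (y : Cover d) :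
    Integrable fun s => (mollifier d k).normed volume s * f (y - s) := by
  refine Continuous.integrable_of_hasCompactSupport ?_ ?_
  · exact (mollifier d k).continuous_normed.mul (by fun_prop)
  · exact (mollifier d k).hasCompactSupport_normed.mul_right

theorem lipschitzWith_mollify {K : ℝ≥0} {f : Cover d → ℝ} (hf : LipschitzWith K f) (k : ℕ) :
    LipschitzWith K (mollify k f) := by
  refine LipschitzWith.of_dist_le_mul fun y y' => ?_
  have hi : Integrable ((mollifier d k).normed (volume : Measure (Cover d))) :=
    (mollifier d k).integrable_normed
  rw [dist_eq_norm, ConsLaw.mollify, ConsLaw.mollify,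
    ← integral_sub (integrable_mollifier_mul k hf.continuous y)
    (integrable_mollifier_mul k hf.continuous y')]
  calc _ ≤ ∫ s, (mollifier d k).normed volume s * (K * dist y y') := by
        refine norm_integral_le_of_norm_le (hi.mul_const _) (ae_of_all _ fun s => ?_)
        rw [← mul_sub, norm_mul, Real.norm_of_nonneg ((mollifier d k).nonneg_normed s)]
        refine mul_le_mul_of_nonneg_left ?_ ((mollifier d k).nonneg_normed s)
        simpa [dist_eq_norm] using hf.dist_le_mul (y - s) (y' - s)
    _ = _ := by rw [integral_mul_const, (mollifier d k).integral_normed, one_mul]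

/-- The Lipschitz bound dominates the difference quotients, and differentiability of `f` at almost
every `y - s` is enough under the integral. -/
theorem lineDeriv_mollify {K : ℝ≥0} {f : Cover d → ℝ} (hf : LipschitzWith K f) (k : ℕ)
    (v y : Cover d) :
    lineDeriv ℝ (mollify k f) y v = mollify k (fun y => lineDeriv ℝ f y v) y := by
  have hi : Integrable ((mollifier d k).normed (volume : Measure (Cover d))) :=
    (mollifier d k).integrable_normed
  have hae : ∀ᵐ s : Cover d, LineDifferentiableAt ℝ f (y - s) v :=
    (quasiMeasurePreserving_sub_left volume y).ae (hf.ae_lineDifferentiableAt v)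
  have := hasDerivAt_integral_of_dominated_loc_of_lip (𝕜 := ℝ) (μ := (volume : Measure (Cover d)))
    (F := fun (r : ℝ) s => (mollifier d k).normed volume s * f (y + r • v - s))
    (F' := fun s => (mollifier d k).normed volume s * lineDeriv ℝ f (y - s) v)
    (bound := fun s => (mollifier d k).normed volume s * (K * ‖v‖))
    (x₀ := 0) (s := Set.univ) univ_mem
    (Eventually.of_forall fun r => (integrable_mollifier_mul k hf.continuous _).1)
    (integrable_mollifier_mul k hf.continuous _) ?_ ?_ (hi.mul_const _) ?_
  · exact this.2.deriv
  · exact (mollifier d k).continuous_normed.aestronglyMeasurable.mul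
      (((measurable_lineDeriv (𝕜 := ℝ) (v := v) hf.continuous).comp
        (measurable_const.sub measurable_id)).aestronglyMeasurable)
  · refine ae_of_all _ fun s => LipschitzOnWith.of_dist_le_mul fun r _ r' _ => ?_
    have hn := (mollifier d k).nonneg_normed (μ := volume) s
    rw [Real.coe_nnabs, abs_of_nonneg (by positivity), Real.dist_eq, ← mul_sub, abs_mul,
      abs_of_nonneg hn, mul_assoc]
    refine mul_le_mul_of_nonneg_left ?_ hn
    have := hf.dist_le_mul (y + r • v - s) (y + r' • v - s)
    rw [dist_eq_norm (y + r • v - s), sub_sub_sub_cancel_right, add_sub_add_left_eq_sub,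
      ← sub_smul, norm_smul] at this
    rw [Real.dist_eq] at this ⊢
    rw [Real.norm_eq_abs] at this
    linarith
  · filter_upwards [hae] with s hs
    have h1 : HasDerivAt (fun r : ℝ => f (y - s + r • v)) (lineDeriv ℝ f (y - s) v) 0 :=
      hs.hasLineDerivAt
    have h2 := h1.const_mul ((mollifier d k).normed volume s)
    refine h2.congr_of_eventuallyEq (Eventually.of_forall fun r => ?_)
    simp only [sub_add_eq_add_sub]

theorem tendsto_mollifier_rOut : Tendsto (fun k => (mollifier d k).rOut) atTop (𝓝 0) :=
  tendsto_one_div_add_atTop_nhds_zero_nat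

/-- Smooth approximation of Lipschitz functions on `𝕋ᵈ × ℝ`. -/
theorem exists_mollification {K : ℝ≥0} {φ : Torus d × ℝ → ℝ} (hφ : LipschitzWith K (φ ∘ proj d)) :
    ∃ φk : ℕ → Torus d × ℝ → ℝ, (∀ k, ContDiff ℝ ∞ (φk k ∘ proj d)) ∧
      (∀ k, LipschitzWith K (φk k ∘ proj d)) ∧
      (∀ z, Tendsto (fun k => φk k z) atTop (𝓝 (φ z))) ∧
      (∀ v, ∀ᵐ z, Tendsto (fun k => dirDeriv v (φk k) z) atTop (𝓝 (dirDeriv v φ z))) ∧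
      ∀ τ, (∀ x t, τ ≤ t → φ (x, t) = 0) →
        ∀ (k : ℕ) x t, τ + 1 / ((k : ℝ) + 1) ≤ t → φk k (x, t) = 0 := by
  have hc := hφ.continuous
  -- Convolution commutes with translations, so the mollified lift is again periodic and descends to
  -- the torus.
  have hper : ∀ k y y', proj d y = proj d y' →
      mollify k (φ ∘ proj d) y = mollify k (φ ∘ proj d) y' := by
    intro k y y' h
    simp only [mollify, Function.comp, map_sub, h]
  have hcomp : ∀ k, (fun z => mollify k (φ ∘ proj d) (sect z)) ∘ proj d =
      mollify k (φ ∘ proj d) := fun k => funext fun y => hper k _ _ (proj_sect _)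
  refine ⟨fun k z => mollify k (φ ∘ proj d) (sect z), fun k => ?_, fun k => ?_, fun z => ?_,
    fun v => ?_, fun τ hτ k x t ht => ?_⟩
  · rw [hcomp, mollify_eq]
    exact (mollifier d k).hasCompactSupport_normed.contDiff_convolution_left _
      (mollifier d k).contDiff_normed hc.locallyIntegrable
  · rw [hcomp]
    exact lipschitzWith_mollify hφ k
  · have := ContDiffBump.convolution_tendsto_right_of_continuous
      (tendsto_mollifier_rOut (d := d)) (μ := volume) hc (sect z)
    simpa [mollify_eq] using this
  -- Derivatives of mollifications are mollifications of the derivative, and these converge almost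
  -- everywhere since the kernels have comparable inner and outer radii (ratio 2).
  · have h1 := ContDiffBump.ae_convolution_tendsto_right_of_locallyIntegrable
      (φ := fun k => mollifier d k) (μ := (volume : Measure (Cover d))) (K := 2)
      tendsto_mollifier_rOut (Eventually.of_forall fun k => by
        simp only [mollifier]
        linarith)
      (hφ.locallyIntegrable_lineDeriv v)
    filter_upwards [ae_sect h1] with z hz
    refine hz.congr fun k => ?_
    rw [← mollify_eq, ← lineDeriv_mollify hφ, dirDeriv, hcomp]
  · refine integral_eq_zero_of_ae (ae_of_all _ fun s => ?_)
    by_cases hs : s ∈ Metric.ball (0 : Cover d) (mollifier d k).rOut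
    · have h1 : |s.2| < 1 / ((k : ℝ) + 1) := by
        rw [mem_ball_zero_iff] at hs
        exact (le_max_right _ _).trans_lt hs
      have h2 : (φ ∘ proj d) (sect (x, t) - s) = 0 := by
        refine hτ _ _ ?_
        have := (abs_lt.1 h1).2
        simp only [Prod.snd_sub, sect_snd]
        linarith
      simp only [h2, mul_zero, Pi.zero_apply]
    · rw [← (mollifier d k).support_normed_eq (μ := volume), Function.notMem_support] at hs
      simp [hs]

/-- A weak formulation valid for `C¹` test functions extends to Lipschitz test functions. -/
theorem weak_form_of_lipschitz {T : ℝ} {a : Torus d × ℝ → ℝ} {b : Fin d → Torus d × ℝ → ℝ}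
    {c : Torus d → ℝ} (ha : Integrable a (cylVol d T)) (hb : ∀ α, Integrable (b α) (cylVol d T))
    (hc : Integrable c)
    (h : ∀ φ, IsTest T φ → ∫ z, a z * dt φ z ∂(cylVol d T)
      + ∫ z, ∑ α, b α z * dx α φ z ∂(cylVol d T) + (∫ x, c x * φ (x, 0)) = 0)
    {φ : Torus d × ℝ → ℝ} {K : ℝ≥0} (hφ : LipschitzWith K (φ ∘ proj d))
    {τ : ℝ} (hτ : τ < T) (h0 : ∀ x t, τ ≤ t → φ (x, t) = 0) :
    ∫ z, a z * dt φ z ∂(cylVol d T)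
      + ∫ z, ∑ α, b α z * dx α φ z ∂(cylVol d T) + (∫ x, c x * φ (x, 0)) = 0 := by
  obtain ⟨φk, hs, hl, hlim, hdlim, hz⟩ := exists_mollification hφ
  have hck : ∀ k, Continuous (φk k) := fun k => continuous_of_comp_proj (hl k).continuous
  have hcφ : Continuous φ := continuous_of_comp_proj hφ.continuous
  have t1 : Tendsto (fun k => ∫ z, a z * dt (φk k) z ∂(cylVol d T)) atTop
      (𝓝 (∫ z, a z * dt φ z ∂(cylVol d T))) := by
    refine tendsto_integral_of_dominated_convergence (fun z => ‖a z‖ * (K * ‖timeDir d‖))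
      (fun k => ?_) (ha.norm.mul_const _) (fun k => ae_of_all _ fun z => ?_) ?_
    · simp only [dt_eq]
      exact ha.1.mul (measurable_dirDeriv (hl k).continuous).aestronglyMeasurable
    · rw [norm_mul, dt_eq]
      exact mul_le_mul_of_nonneg_left (norm_dirDeriv_le (hl k) z) (norm_nonneg _)
    · filter_upwards [ae_cylVol_of_ae (hdlim (timeDir d))] with z hz
      simp only [dt_eq]
      exact hz.const_mul _
  have t2 : Tendsto (fun k => ∫ z, ∑ α, b α z * dx α (φk k) z ∂(cylVol d T)) atTop
      (𝓝 (∫ z, ∑ α, b α z * dx α φ z ∂(cylVol d T))) := by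
    refine tendsto_integral_of_dominated_convergence
      (fun z => ∑ α, ‖b α z‖ * (K * ‖spaceDir α‖))
      (fun k => ?_) (integrable_finsetSum _ fun α _ => (hb α).norm.mul_const _)
      (fun k => ae_of_all _ fun z => ?_) ?_
    · simp only [dx_eq]
      exact Finset.aestronglyMeasurable_fun_sum _ fun α _ =>
        (hb α).1.mul (measurable_dirDeriv (hl k).continuous).aestronglyMeasurable
    · refine (norm_sum_le _ _).trans (Finset.sum_le_sum fun α _ => ?_)
      rw [norm_mul, dx_eq]
      exact mul_le_mul_of_nonneg_left (norm_dirDeriv_le (hl k) z) (norm_nonneg _)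
    · filter_upwards [ae_cylVol_of_ae (ae_all_iff.2 fun α => hdlim (spaceDir α))] with z hz
      simp only [dx_eq]
      exact tendsto_finsetSum _ fun α _ => (hz α).const_mul _
  have t3 : Tendsto (fun k => ∫ x, c x * φk k (x, 0)) atTop (𝓝 (∫ x, c x * φ (x, 0))) := by
    have hx0 : Tendsto (fun k => φk k 0) atTop (𝓝 (φ 0)) := hlim 0
    obtain ⟨B, hB⟩ := (Metric.isBounded_range_of_tendsto _ hx0).exists_norm_le
    -- Convergence at one point bounds the values there; the common Lipschitz constant spreads the
    -- bound over a fundamental box of sup-norm size `2π`.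
    have hbd : ∀ k x, ‖φk k (x, 0)‖ ≤ B + K * (2 * Real.pi) := by
      intro k x
      have h1 := (hl k).dist_le_mul (sect (x, 0)) (0, 0)
      have h2 : dist (sect (x, (0 : ℝ))) (0, 0) ≤ 2 * Real.pi := by
        rw [Prod.dist_eq]
        refine max_le ((dist_pi_le_iff (by positivity)).2 fun i => ?_) ?_
        · have := (AddCircle.measurableEquivIoc (2 * Real.pi) 0 (x i)).2
          simp only [zero_add, Set.mem_Ioc] at this
          rw [Real.dist_eq]
          change |((AddCircle.measurableEquivIoc (2 * Real.pi) 0 (x i) : _) : ℝ) - 0| ≤ _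
          rw [sub_zero, abs_of_pos this.1]
          exact this.2
        · simp [Real.pi_pos.le]
      simp only [Function.comp, proj_sect] at h1
      have h3 : proj d (0, 0) = 0 := map_zero _
      rw [h3, dist_eq_norm] at h1
      have h4 : ‖φk k 0‖ ≤ B := hB _ ⟨k, rfl⟩
      calc _ ≤ ‖φk k 0‖ + ‖φk k (x, 0) - φk k 0‖ := by
            have := norm_add_le (φk k 0) (φk k (x, 0) - φk k 0)
            rwa [add_sub_cancel] at this
        _ ≤ B + K * (2 * Real.pi) := add_le_add h4 (h1.trans (by gcongr))
    refine tendsto_integral_of_dominated_convergence (fun x => ‖c x‖ * (B + K * (2 * Real.pi)))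
      (fun k => ?_) (hc.norm.mul_const _) (fun k => ae_of_all _ fun x => ?_)
      (ae_of_all _ fun x => (hlim _).const_mul _)
    · have : Continuous fun x => φk k (x, 0) := by have := hck k; fun_prop
      exact hc.1.mul this.aestronglyMeasurable
    · rw [norm_mul]
      exact mul_le_mul_of_nonneg_left (hbd k x) (norm_nonneg _)
  -- Mollification enlarges the time support by `1 / (k + 1)`, so `φk k` is admissible once this is
  -- below `T - τ`.
  obtain ⟨k₀, hk₀⟩ := exists_nat_one_div_lt (sub_pos.2 hτ)
  have hev : ∀ᶠ k in atTop, ∫ z, a z * dt (φk k) z ∂(cylVol d T)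
      + ∫ z, ∑ α, b α z * dx α (φk k) z ∂(cylVol d T) + (∫ x, c x * φk k (x, 0)) = 0 := by
    filter_upwards [eventually_ge_atTop k₀] with k hk
    refine h _ ⟨(hs k).of_le (by exact_mod_cast le_top), τ + 1 / ((k : ℝ) + 1), ?_, hz τ h0 k⟩
    have := Nat.one_div_le_one_div (α := ℝ) hk
    linarith
  exact tendsto_nhds_unique ((t1.add t2).add t3)
    (tendsto_const_nhds.congr' (hev.mono fun k hk => hk.symm))

end Mollify

/-! ### Growth, composition with the strong solution, and time weights. -/

section ChainRule

variable {n d : ℕ}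

/-- This makes the averages of `A` and `F_α` integrable as soon as that of `η` is. The added `1`
handles the compact set where `η` may be small. -/
theorem exists_growth_bound {W : Type*} [NormedAddCommGroup W] {η : State n → ℝ}
    (hη0 : ∀ u, 0 ≤ η u) (hη : Tendsto η (cocompact (State n)) atTop) {g : State n → W}
    (hg : Continuous g)
    (hlim : Tendsto (fun u => ‖g u‖ / η u) (cocompact (State n)) (𝓝 0)) :
    ∃ c, ∀ u, ‖g u‖ ≤ c * (η u + 1) := by
  have hev : ∀ᶠ u in cocompact (State n), ‖g u‖ ≤ η u := by
    filter_upwards [hη.eventually_gt_atTop 0, hlim.eventually_le_const zero_lt_one] with u h1 h2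
    simpa using (div_le_iff₀ h1).1 h2
  obtain ⟨t, ht, htc⟩ := mem_cocompact.1 hev
  obtain ⟨C, hC⟩ := ht.exists_bound_of_continuousOn hg.continuousOn
  refine ⟨max C 1, fun u => ?_⟩
  by_cases hu : u ∈ t
  · calc ‖g u‖ ≤ max C 1 := (hC u hu).trans (le_max_left _ _)
      _ ≤ max C 1 * (η u + 1) :=
        le_mul_of_one_le_right (by positivity) (by linarith [hη0 u])
  · calc ‖g u‖ ≤ η u + 1 := (htc hu).trans (by linarith)
      _ ≤ max C 1 * (η u + 1) :=
        le_mul_of_one_le_left (by linarith [hη0 u]) (le_max_right _ _)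

/-- The composite of a function on `ℝ × ℝⁿ` with `(t, v(x,t))`, frozen in time outside `[0,T]`. -/
def evalAlong (T : ℝ) (v : Torus d × ℝ → State n) (g : ℝ × State n → ℝ) (z : Torus d × ℝ) : ℝ :=
  g (max 0 (min z.2 T), v z)

theorem exists_lipschitzWith_evalAlong {T : ℝ} (hT : 0 ≤ T) {v : Torus d × ℝ → State n} {K : ℝ≥0}
    (hv : LipschitzWith K (v ∘ proj d)) {R : ℝ} (hR : ∀ z, ‖v z‖ ≤ R) {g : ℝ × State n → ℝ}
    (hg : ContDiff ℝ 1 g) : ∃ K' : ℝ≥0, LipschitzWith K' (evalAlong T v g ∘ proj d) := by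
  have hcl : LipschitzWith 1 fun y : Cover d => max 0 (min y.2 T) :=
    LipschitzWith.of_dist_le_mul fun y y' => by
      rw [NNReal.coe_one, one_mul, Real.dist_eq]
      exact (abs_clamp_sub_le T y.2 y'.2).trans
        ((Real.dist_eq _ _).symm.le.trans (le_max_right _ _))
  -- Freezing time outside `[0,T]` keeps the arguments of `g` in a bounded set, where a `C¹`
  -- function is Lipschitz.
  refine exists_lipschitzWith_comp hg (hcl.prodMk hv) (R := max T R) fun y => ?_
  refine max_le_max ?_ (hR _)
  change ‖max 0 (min y.2 T)‖ ≤ T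
  rw [Real.norm_of_nonneg (le_max_left _ _)]
  exact max_le hT (min_le_right _ _)

theorem dirDeriv_evalAlong {T : ℝ} {v : Torus d × ℝ → State n} {g : ℝ × State n → ℝ}
    (hg : ContDiff ℝ 1 g) {z : Torus d × ℝ} (hz : z.2 ∈ Set.Ioo 0 T)
    (hv : DifferentiableAt ℝ (v ∘ proj d) (sect z)) (w : Cover d) :
    dirDeriv w (evalAlong T v g) z =
      fderiv ℝ g (z.2, v z) (w.2, fderiv ℝ (v ∘ proj d) (sect z) w) := by
  have hcl : HasFDerivAt (fun y : Cover d => max 0 (min y.2 T))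
      (ContinuousLinearMap.snd ℝ (Fin d → ℝ) ℝ) (sect z) := by
    refine hasFDerivAt_snd.congr_of_eventuallyEq ?_
    have : {y : Cover d | y.2 ∈ Set.Ioo 0 T} ∈ 𝓝 (sect z) :=
      (isOpen_Ioo.preimage continuous_snd).mem_nhds hz
    filter_upwards [this] with y hy
    rw [min_eq_left hy.2.le, max_eq_right hy.1.le]
  have hpt : (max 0 (min (sect z).2 T), (v ∘ proj d) (sect z)) = (z.2, v z) := by
    simp [min_eq_left hz.2.le, max_eq_right hz.1.le]
  have h1 : HasFDerivAt g (fderiv ℝ g (z.2, v z))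
      (max 0 (min (sect z).2 T), (v ∘ proj d) (sect z)) := by
    rw [hpt]
    exact (hg.differentiable one_ne_zero _).hasFDerivAt
  have h2 := h1.comp (sect z) (hcl.prodMk hv.hasFDerivAt)
  have h3 : HasFDerivAt (evalAlong T v g ∘ proj d) _ (sect z) := h2
  rw [dirDeriv_eq_fderiv h3.differentiableAt, h3.fderiv]
  rfl

/-- Strong solutions satisfy the equation pointwise almost everywhere. -/
theorem strong_equation {T : ℝ} (hT : 0 < T) {v : Torus d × ℝ → State n} {K : ℝ≥0}
    (hv : LipschitzWith K (v ∘ proj d)) {R : ℝ} (hR : ∀ z, ‖v z‖ ≤ R)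
    {F : Fin d → State n → State n} (hF : ∀ α, ContDiff ℝ 1 (F α))
    {a : Torus d × ℝ → State n} {f : Fin d → Torus d × ℝ → State n}
    (ha : HasWeakDt T v a) (hf : ∀ α, HasWeakDx T α (fun z => F α (v z)) (f α))
    (heq : ∀ᵐ z ∂(cylVol d T), a z + ∑ α, f α z = 0) :
    ∀ᵐ z ∂(cylVol d T), DifferentiableAt ℝ (v ∘ proj d) (sect z) ∧
      fderiv ℝ (v ∘ proj d) (sect z) (timeDir d) +
        ∑ α, fderiv ℝ (F α) (v z) (fderiv ℝ (v ∘ proj d) (sect z) (spaceDir α)) = 0 := by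
  have hvc : Continuous v := continuous_of_comp_proj hv.continuous
  have hcomp : ∀ {w : Torus d × ℝ → State n} {L : ℝ≥0}, LipschitzWith L (w ∘ proj d) →
      ∀ i, LipschitzWith L ((fun z => w z i) ∘ proj d) := fun {w L} hw i =>
    LipschitzWith.of_dist_le_mul fun y y' => by
      refine le_trans ?_ (hw.dist_le_mul y y')
      have := PiLp.norm_apply_le (w (proj d y) - w (proj d y')) i
      rwa [dist_eq_norm, dist_eq_norm]
  have hcint : ∀ {g : Torus d × ℝ → State n}, MemLp g ⊤ (cylVol d T) → ∀ i,
      Integrable (fun z => g z i) (cylVol d T) := fun hg i =>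
    (EuclideanSpace.proj (𝕜 := ℝ) i).integrable_comp (hg.integrable le_top)
  have ht : ∀ i, ∀ᵐ z ∂(cylVol d T), dirDeriv (timeDir d) (fun z => v z i) z = a z i := fun i => by
    refine dirDeriv_ae_eq_of_weak (fun ψ L hψ h0 h1 => ?_) (hcomp hv i)
      (fun z => (PiLp.norm_apply_le _ _).trans (hR z)) (hcint ha.1 i)
      (fun φ hφ => component_weak hvc ha.1 i hφ (by simpa only [dt_eq] using ha.2 φ hφ))
    have := integral_dt_of_lipschitz hT.le hψ
    simpa [dt_eq, h0, h1] using this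
  have hFv : ∀ α, ∃ L : ℝ≥0, LipschitzWith L ((fun z => F α (v z)) ∘ proj d) := fun α =>
    exists_lipschitzWith_comp (hF α) hv fun y => hR _
  have hFb : ∀ α, ∃ B, ∀ z, ‖F α (v z)‖ ≤ B := fun α => by
    obtain ⟨B, hB⟩ := (isCompact_closedBall (0 : State n) R).exists_bound_of_continuousOn
      (hF α).continuous.continuousOn
    exact ⟨B, fun z => hB _ (by simpa using hR z)⟩
  have hx : ∀ α i, ∀ᵐ z ∂(cylVol d T),
      dirDeriv (spaceDir α) (fun z => F α (v z) i) z = f α z i := fun α i => by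
    obtain ⟨L, hL⟩ := hFv α
    obtain ⟨B, hB⟩ := hFb α
    have hc : Continuous fun z => F α (v z) := (hF α).continuous.comp hvc
    exact dirDeriv_ae_eq_of_weak (fun ψ L hψ h0 h1 => integral_dirDeriv_of_snd_eq_zero rfl hψ)
      (hcomp hL i) (fun z => (PiLp.norm_apply_le _ _).trans (hB z)) (hcint (hf α).1 i)
      (fun φ hφ => component_weak hc (hf α).1 i hφ
        (by simpa only [dx_eq] using (hf α).2 φ hφ))
  filter_upwards [heq, ae_all_iff.2 ht, ae_all_iff.2 fun α => ae_all_iff.2 (hx α),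
    ae_cylVol_of_ae (ae_differentiableAt_sect hv)] with z h1 h2 h3 h4
  refine ⟨h4, ?_⟩
  have c1 : fderiv ℝ (v ∘ proj d) (sect z) (timeDir d) = a z := by
    ext i
    rw [← h2 i]
    have := ((EuclideanSpace.proj (𝕜 := ℝ) i).hasFDerivAt (x := (v ∘ proj d) (sect z))).comp _
      h4.hasFDerivAt
    have h5 : HasFDerivAt ((fun z => v z i) ∘ proj d) _ (sect z) := this
    rw [dirDeriv_eq_fderiv h5.differentiableAt, h5.fderiv]
    rfl
  have c2 : ∀ α, fderiv ℝ (F α) (v z) (fderiv ℝ (v ∘ proj d) (sect z) (spaceDir α)) = f α z := by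
    intro α
    ext i
    rw [← h3 α i]
    have hFd : HasFDerivAt (F α) (fderiv ℝ (F α) (v z)) ((v ∘ proj d) (sect z)) := by
      have : (v ∘ proj d) (sect z) = v z := by simp
      rw [this]
      exact ((hF α).differentiable one_ne_zero _).hasFDerivAt
    have := ((EuclideanSpace.proj (𝕜 := ℝ) i).hasFDerivAt
      (x := (F α) ((v ∘ proj d) (sect z)))).comp (sect z) (hFd.comp (sect z) h4.hasFDerivAt)
    have h5 : HasFDerivAt ((fun z => F α (v z) i) ∘ proj d) _ (sect z) := this
    rw [dirDeriv_eq_fderiv h5.differentiableAt, h5.fderiv]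
    rfl
  rw [c1, Finset.sum_congr rfl fun α _ => c2 α, h1]

/-- Exponentially decaying cutoffs in time. -/
theorem exists_decaying_timeTest {T τ K : ℝ} (hτ : τ < T) :
    ∃ ξ : ℝ → ℝ, IsTimeTest T ξ ∧ (∀ t, 0 ≤ ξ t) ∧ (∀ t, deriv ξ t ≤ -K * ξ t) ∧
      (∀ t < τ, 0 < ξ t) ∧ ∀ t, τ ≤ t → ξ t = 0 := by
  have hs : ContDiff ℝ 1 fun t : ℝ => Real.smoothTransition (τ - t) :=
    Real.smoothTransition.contDiff.comp (contDiff_const.sub contDiff_id)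
  have he : ContDiff ℝ 1 fun t : ℝ => Real.exp (-K * t) := by fun_prop
  have hanti : Antitone fun t : ℝ => Real.smoothTransition (τ - t) := fun s t hst =>
    Real.smoothTransition.monotone (by linarith)
  have hz : ∀ t, τ ≤ t → Real.exp (-K * t) * Real.smoothTransition (τ - t) = 0 := fun t ht => by
    rw [Real.smoothTransition.zero_of_nonpos (by linarith), mul_zero]
  have h0 : ∀ t, 0 ≤ Real.exp (-K * t) * Real.smoothTransition (τ - t) := fun t =>
    mul_nonneg (Real.exp_pos _).le (Real.smoothTransition.nonneg _)
  -- The nonincreasing cutoff adds a nonpositive term to the derivative of the exponential, so `ξ' ≤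
  -- -K ξ` survives it.
  refine ⟨fun t => Real.exp (-K * t) * Real.smoothTransition (τ - t),
    ⟨he.mul hs, ⟨τ, hτ, hz⟩, fun t _ => h0 t⟩, h0, fun t => ?_, fun t ht =>
    mul_pos (Real.exp_pos _) (Real.smoothTransition.pos_of_pos (by linarith)), hz⟩
  have d1 : HasDerivAt (fun t : ℝ => Real.exp (-K * t)) (Real.exp (-K * t) * -K) t := by
    simpa using ((hasDerivAt_id t).const_mul (-K)).exp
  have d2 := (hs.differentiable one_ne_zero t).hasDerivAt
  have d3 : HasDerivAt (fun t => Real.exp (-K * t) * Real.smoothTransition (τ - t)) _ t :=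
    d1.mul d2
  rw [d3.deriv]
  have h1 : deriv (fun t : ℝ => Real.smoothTransition (τ - t)) t ≤ 0 := hanti.deriv_nonpos
  have h2 := mul_nonpos_of_nonneg_of_nonpos (Real.exp_pos (-K * t)).le h1
  linarith

end ChainRule

/-! ### The relative entropy identity and its source terms. -/

section RelativeEntropy

variable {n d : ℕ} {f : State n → ℝ} {Γ : State n → State n}
  {F : Fin d → State n → State n} {q : Fin d → State n → ℝ}

/-- The relative entropy. -/
noncomputable def relEntropy (f : State n → ℝ) (Γ : State n → State n) (y y' : State n) : ℝ :=
  f y - f y' - inner ℝ (Γ y') (y - y')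

/-- The test function `ξ Γᵢ(v)` in the averaged conservation law. -/
noncomputable def gradTest (Γ : State n → State n) (ξ : ℝ → ℝ) (i : Fin n) (p : ℝ × State n) : ℝ :=
  ξ p.1 * Γ p.2 i

/-- The weighted Legendre transform of the entropy. -/
noncomputable def legendreTest (f : State n → ℝ) (Γ : State n → State n) (ξ : ℝ → ℝ)
    (p : ℝ × State n) : ℝ :=
  ξ p.1 * (f p.2 - inner ℝ p.2 (Γ p.2))

/-- The weighted flux of `legendreTest`. -/
noncomputable def legendreFluxTest (Γ : State n → State n) (F : State n → State n)
    (q : State n → ℝ) (ξ : ℝ → ℝ) (p : ℝ × State n) : ℝ :=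
  ξ p.1 * (q p.2 - inner ℝ (F p.2) (Γ p.2))

theorem contDiff_mul_weight {ξ : ℝ → ℝ} (hξ : ContDiff ℝ 1 ξ) {k : State n → ℝ}
    (hk : ContDiff ℝ 1 k) : ContDiff ℝ 1 fun p : ℝ × State n => ξ p.1 * k p.2 :=
  (hξ.comp contDiff_fst).mul (hk.comp contDiff_snd)

theorem fderiv_mul_weight {ξ : ℝ → ℝ} (hξ : ContDiff ℝ 1 ξ) {k : State n → ℝ} {y : State n}
    {k' : State n →L[ℝ] ℝ} (hk : HasFDerivAt k k' y) (t s : ℝ) (h : State n) :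
    fderiv ℝ (fun p : ℝ × State n => ξ p.1 * k p.2) (t, y) (s, h) =
      deriv ξ t * s * k y + ξ t * k' h := by
  have h1 : HasFDerivAt (fun p : ℝ × State n => ξ p.1) _ (t, y) :=
    (hξ.differentiable one_ne_zero t).hasDerivAt.hasFDerivAt.comp (t, y) hasFDerivAt_fst
  have h2 : HasFDerivAt (fun p : ℝ × State n => k p.2) _ (t, y) :=
    HasFDerivAt.comp (t, y) (g := k) hk hasFDerivAt_snd
  have h3 : HasFDerivAt (fun p : ℝ × State n => ξ p.1 * k p.2) _ (t, y) := h1.mul h2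
  rw [h3.fderiv]
  simp
  ring

theorem ConservedForm.relEntropy_pos (hC : ConservedForm f Γ F q) {y y' : State n} (h : y ≠ y') :
    0 < relEntropy f Γ y y' :=
  bregman_pos hC.hasFDerivAt hC.contDiff_grad hC.pos h

theorem ConservedForm.relEntropy_nonneg (hC : ConservedForm f Γ F q) (y y' : State n) :
    0 ≤ relEntropy f Γ y y' :=
  bregman_nonneg hC.hasFDerivAt hC.contDiff_grad hC.pos y y'

theorem ConservedForm.hasFDerivAt_grad (hC : ConservedForm f Γ F q) (y : State n) :
    HasFDerivAt Γ (fderiv ℝ Γ y) y :=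
  (hC.contDiff_grad.differentiable one_ne_zero y).hasFDerivAt

theorem ConservedForm.contDiff_gradTest (hC : ConservedForm f Γ F q) {ξ : ℝ → ℝ}
    (hξ : ContDiff ℝ 1 ξ) (i : Fin n) : ContDiff ℝ 1 (gradTest Γ ξ i) :=
  contDiff_mul_weight hξ ((EuclideanSpace.proj (𝕜 := ℝ) i).contDiff.comp hC.contDiff_grad)

theorem ConservedForm.contDiff_legendreTest (hC : ConservedForm f Γ F q) {ξ : ℝ → ℝ}
    (hξ : ContDiff ℝ 1 ξ) : ContDiff ℝ 1 (legendreTest f Γ ξ) :=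
  contDiff_mul_weight hξ (hC.contDiff_f.sub (contDiff_id.inner ℝ hC.contDiff_grad))

theorem ConservedForm.contDiff_legendreFluxTest (hC : ConservedForm f Γ F q) {ξ : ℝ → ℝ}
    (hξ : ContDiff ℝ 1 ξ) (α : Fin d) : ContDiff ℝ 1 (legendreFluxTest Γ (F α) (q α) ξ) :=
  contDiff_mul_weight hξ ((hC.contDiff_q α).sub
    (((hC.contDiff_flux α).of_le one_le_two).inner ℝ hC.contDiff_grad))

theorem ConservedForm.fderiv_gradTest (hC : ConservedForm f Γ F q) {ξ : ℝ → ℝ}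
    (hξ : ContDiff ℝ 1 ξ) (i : Fin n) (t s : ℝ) (y h : State n) :
    fderiv ℝ (gradTest Γ ξ i) (t, y) (s, h) =
      deriv ξ t * s * Γ y i + ξ t * (fderiv ℝ Γ y h) i :=
  fderiv_mul_weight hξ ((EuclideanSpace.proj (𝕜 := ℝ) i).hasFDerivAt.comp y
    (hC.hasFDerivAt_grad y)) t s h

/-- Since `∇f = Γ`, the gradient of `f - y · Γ` is just `-y · ∇Γ`. For the flux version, `∇q = Γ ·
∇F` plays the same role. -/
theorem ConservedForm.fderiv_legendreTest (hC : ConservedForm f Γ F q) {ξ : ℝ → ℝ}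
    (hξ : ContDiff ℝ 1 ξ) (t s : ℝ) (y h : State n) :
    fderiv ℝ (legendreTest f Γ ξ) (t, y) (s, h) =
      deriv ξ t * s * (f y - inner ℝ y (Γ y)) - ξ t * inner ℝ y (fderiv ℝ Γ y h) := by
  have h1 := (hC.hasFDerivAt y).sub ((hasFDerivAt_id y).inner ℝ (hC.hasFDerivAt_grad y))
  have h2 := fderiv_mul_weight hξ h1 t s h
  refine h2.trans ?_
  simp [fderivInnerCLM_apply, real_inner_comm]
  ring

theorem ConservedForm.fderiv_legendreFluxTest (hC : ConservedForm f Γ F q) {ξ : ℝ → ℝ}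
    (hξ : ContDiff ℝ 1 ξ) (α : Fin d) (t s : ℝ) (y h : State n) :
    fderiv ℝ (legendreFluxTest Γ (F α) (q α) ξ) (t, y) (s, h) =
      deriv ξ t * s * (q α y - inner ℝ (F α y) (Γ y)) -
        ξ t * inner ℝ (F α y) (fderiv ℝ Γ y h) := by
  have h0 := ((hC.contDiff_flux α).differentiable two_ne_zero y).hasFDerivAt
  have h1 := (((hC.contDiff_q α).differentiable one_ne_zero y).hasFDerivAt).sub
    (h0.inner ℝ (hC.hasFDerivAt_grad y))
  have h2 := fderiv_mul_weight hξ h1 t s h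
  refine h2.trans ?_
  simp [fderivInnerCLM_apply, hC.fderiv_q, real_inner_comm]
  ring

/-- The source terms of the relative entropy identity only involve the relative fluxes. -/
theorem ConservedForm.source_eq (hC : ConservedForm f Γ F q) {y yl vt : State n}
    {vx : Fin d → State n} (heq : vt + ∑ α, fderiv ℝ (F α) y (vx α) = 0) :
    inner ℝ (yl - y) (fderiv ℝ Γ y vt) + ∑ α, inner ℝ (F α yl - F α y) (fderiv ℝ Γ y (vx α)) =
      ∑ α, inner ℝ (F α yl - F α y - fderiv ℝ (F α) y (yl - y)) (fderiv ℝ Γ y (vx α)) := by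
  -- The time derivative is eliminated through the equation. Symmetry of `∇Γ`, then of `∇Γᵀ∇F_α`,
  -- moves `∇F_α` onto `yl - y`, producing the linear part of the relative flux.
  have h1 : vt = -∑ α, fderiv ℝ (F α) y (vx α) := eq_neg_of_add_eq_zero_left heq
  have h2 : inner ℝ (yl - y) (fderiv ℝ Γ y vt) =
      -∑ α, inner ℝ (fderiv ℝ (F α) y (yl - y)) (fderiv ℝ Γ y (vx α)) := by
    rw [real_inner_comm, hC.symm, h1, inner_neg_right, inner_sum]
    congr 1
    refine Finset.sum_congr rfl fun α _ => ?_
    rw [hC.symm_flux, real_inner_comm]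
  rw [h2, neg_add_eq_sub, ← Finset.sum_sub_distrib]
  exact Finset.sum_congr rfl fun α _ => (inner_sub_left _ _ _).symm

/-- On bounded sets of reference states with bounded gradients, the source terms are controlled by
the relative entropy. -/
theorem ConservedForm.exists_source_bound (hC : ConservedForm f Γ F q) (R L : ℝ) :
    ∃ C, ∀ y vt (vx : Fin d → State n), ‖y‖ ≤ R → (∀ α, ‖vx α‖ ≤ L) →
      vt + ∑ α, fderiv ℝ (F α) y (vx α) = 0 → ∀ yl,
      -(inner ℝ (yl - y) (fderiv ℝ Γ y vt) +
        ∑ α, inner ℝ (F α yl - F α y) (fderiv ℝ Γ y (vx α))) ≤ C * relEntropy f Γ yl y := by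
  choose C hC0 hCb using fun α => exists_relative_flux_bound hC.hasFDerivAt hC.contDiff_grad hC.pos
    (hC.contDiff_flux α) hC.tendsto_atTop (hC.flux_little α) hC.id_little R
  obtain ⟨B, hB⟩ := (isCompact_closedBall (0 : State n) R).exists_bound_of_continuousOn
    (hC.contDiff_grad.continuous_fderiv one_ne_zero).continuousOn
  refine ⟨∑ α, C α * (|B| * |L|), fun y vt vx hy hvx heq yl => ?_⟩
  rw [hC.source_eq heq, ← Finset.sum_neg_distrib, Finset.sum_mul]
  refine Finset.sum_le_sum fun α _ => ?_
  have hyb : y ∈ Metric.closedBall (0 : State n) R := by simpa using hy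
  have h1 := hCb α y hyb yl
  have h2 : ‖fderiv ℝ Γ y (vx α)‖ ≤ |B| * |L| :=
    (ContinuousLinearMap.le_opNorm _ _).trans (mul_le_mul ((hB y hyb).trans (le_abs_self _))
      ((hvx α).trans (le_abs_self _)) (norm_nonneg _) (abs_nonneg _))
  calc _ ≤ |inner ℝ (F α yl - F α y - fderiv ℝ (F α) y (yl - y)) (fderiv ℝ Γ y (vx α))| :=
        neg_le_abs _
    _ ≤ ‖F α yl - F α y - fderiv ℝ (F α) y (yl - y)‖ * ‖fderiv ℝ Γ y (vx α)‖ :=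
        abs_real_inner_le_norm _ _
    _ ≤ (C α * relEntropy f Γ yl y) * (|B| * |L|) :=
        mul_le_mul h1 h2 (norm_nonneg _) ((norm_nonneg _).trans h1)
    _ = _ := by ring

/-- The integrand of the relative entropy inequality at the state `yl`. -/
noncomputable def entropyBalance (T : ℝ) (f : State n → ℝ) (Γ : State n → State n)
    (F : Fin d → State n → State n) (q : Fin d → State n → ℝ) (v : Torus d × ℝ → State n)
    (ξ : ℝ → ℝ) (z : Torus d × ℝ) (yl : State n) : ℝ :=
  deriv ξ z.2 * f yl
    - ∑ i, (yl i * dt (evalAlong T v (gradTest Γ ξ i)) z +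
        ∑ α, F α yl i * dx α (evalAlong T v (gradTest Γ ξ i)) z)
    - dt (evalAlong T v (legendreTest f Γ ξ)) z
    - ∑ α, dx α (evalAlong T v (legendreFluxTest Γ (F α) (q α) ξ)) z

/-- The Legendre terms supply exactly the reference values: `f(yl) - yl · Γ(v)` minus `f(v) - v ·
Γ(v)` is the relative entropy, and `yl`, `F_α(yl)` in the source become differences with `v`,
`F_α(v)`. -/
theorem ConservedForm.entropyBalance_eq (hC : ConservedForm f Γ F q) {T : ℝ}
    {v : Torus d × ℝ → State n} {ξ : ℝ → ℝ} (hξ : ContDiff ℝ 1 ξ) {z : Torus d × ℝ}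
    (hz : z.2 ∈ Set.Ioo 0 T) (hv : DifferentiableAt ℝ (v ∘ proj d) (sect z)) (yl : State n) :
    entropyBalance T f Γ F q v ξ z yl = deriv ξ z.2 * relEntropy f Γ yl (v z) -
      ξ z.2 * (inner ℝ (yl - v z)
          (fderiv ℝ Γ (v z) (fderiv ℝ (v ∘ proj d) (sect z) (timeDir d))) +
        ∑ α, inner ℝ (F α yl - F α (v z))
          (fderiv ℝ Γ (v z) (fderiv ℝ (v ∘ proj d) (sect z) (spaceDir α)))) := by
  have hinner : ∀ x y : State n, inner ℝ x y = ∑ i, x i * y i := fun x y => by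
    simp [PiLp.inner_apply, mul_comm]
  have e1 : ∀ i, dt (evalAlong T v (gradTest Γ ξ i)) z = deriv ξ z.2 * Γ (v z) i +
      ξ z.2 * (fderiv ℝ Γ (v z) (fderiv ℝ (v ∘ proj d) (sect z) (timeDir d))) i := fun i => by
    rw [dt_eq, dirDeriv_evalAlong (hC.contDiff_gradTest hξ i) hz hv, hC.fderiv_gradTest hξ]
    simp [timeDir]
  have e2 : ∀ α i, dx α (evalAlong T v (gradTest Γ ξ i)) z =
      ξ z.2 * (fderiv ℝ Γ (v z) (fderiv ℝ (v ∘ proj d) (sect z) (spaceDir α))) i := fun α i => by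
    rw [dx_eq, dirDeriv_evalAlong (hC.contDiff_gradTest hξ i) hz hv, hC.fderiv_gradTest hξ]
    simp [spaceDir]
  have e3 : dt (evalAlong T v (legendreTest f Γ ξ)) z =
      deriv ξ z.2 * (f (v z) - inner ℝ (v z) (Γ (v z))) - ξ z.2 * inner ℝ (v z)
        (fderiv ℝ Γ (v z) (fderiv ℝ (v ∘ proj d) (sect z) (timeDir d))) := by
    rw [dt_eq, dirDeriv_evalAlong (hC.contDiff_legendreTest hξ) hz hv, hC.fderiv_legendreTest hξ]
    simp [timeDir]
  have e4 : ∀ α, dx α (evalAlong T v (legendreFluxTest Γ (F α) (q α) ξ)) z =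
      -(ξ z.2 * inner ℝ (F α (v z))
        (fderiv ℝ Γ (v z) (fderiv ℝ (v ∘ proj d) (sect z) (spaceDir α)))) := fun α => by
    rw [dx_eq, dirDeriv_evalAlong (hC.contDiff_legendreFluxTest hξ α) hz hv,
      hC.fderiv_legendreFluxTest hξ]
    simp [spaceDir]
  rw [entropyBalance, e3]
  simp only [e1, e2, e4]
  generalize fderiv ℝ Γ (v z) (fderiv ℝ (v ∘ proj d) (sect z) (timeDir d)) = Gt
  generalize hGx : (fun α => fderiv ℝ Γ (v z) (fderiv ℝ (v ∘ proj d) (sect z) (spaceDir α))) = Gx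
  have hGx' : ∀ α, fderiv ℝ Γ (v z) (fderiv ℝ (v ∘ proj d) (sect z) (spaceDir α)) = Gx α :=
    fun α => congrFun hGx α
  simp only [hGx']
  have s1 : ∑ i, (yl i * (deriv ξ z.2 * Γ (v z) i + ξ z.2 * Gt i) +
        ∑ α, F α yl i * (ξ z.2 * Gx α i)) =
      deriv ξ z.2 * inner ℝ yl (Γ (v z)) + ξ z.2 * inner ℝ yl Gt +
        ξ z.2 * ∑ α, inner ℝ (F α yl) (Gx α) := by
    rw [Finset.sum_add_distrib, Finset.sum_comm]
    simp only [hinner, Finset.mul_sum, ← Finset.sum_add_distrib]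
    congr 1
    · exact Finset.sum_congr rfl fun i _ => by ring
    · exact Finset.sum_congr rfl fun α _ => Finset.sum_congr rfl fun i _ => by ring
  rw [s1, relEntropy]
  simp only [inner_sub_left, inner_sub_right, Finset.sum_neg_distrib, ← Finset.mul_sum,
    Finset.sum_sub_distrib, real_inner_comm (Γ (v z))]
  ring

end RelativeEntropy

/-! ### The integrated relative entropy inequality. -/

section Uniqueness

variable {n d : ℕ}

theorem measurePreserving_fst_compProd {X Y : Type*} [MeasurableSpace X] [MeasurableSpace Y]
    (μ : Measure X) [SFinite μ] (κ : Kernel X Y) [IsMarkovKernel κ] :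
    MeasurePreserving (Prod.fst : X × Y → X) (μ.compProd κ) μ :=
  ⟨measurable_fst, Measure.fst_compProd μ κ⟩

/-- Averages against the Young measure are rewritten over `μ.compProd κ`, where the integrand can be
estimated pointwise in the state variable. -/
theorem integral_compProd_mul {X Y : Type*} [MeasurableSpace X] [MeasurableSpace Y] {μ : Measure X}
    [SFinite μ] {κ : Kernel X Y} [IsMarkovKernel κ] {g : Y → ℝ}
    (hg : Integrable (fun w : X × Y => g w.2) (μ.compProd κ)) {b : X → ℝ}
    (hb : AEStronglyMeasurable b μ) {C : ℝ} (hC : ∀ᵐ x ∂μ, ‖b x‖ ≤ C) :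
    Integrable (fun w : X × Y => g w.2 * b w.1) (μ.compProd κ) ∧
      ∫ w, g w.2 * b w.1 ∂(μ.compProd κ) = ∫ x, (∫ y, g y ∂(κ x)) * b x ∂μ := by
  have hb' : AEStronglyMeasurable (fun w : X × Y => b w.1) (μ.compProd κ) := by
    have h1 : (μ.compProd κ).fst = μ := Measure.fst_compProd μ κ
    rw [← h1] at hb
    exact hb.comp_measurable measurable_fst
  have hi : Integrable (fun w : X × Y => g w.2 * b w.1) (μ.compProd κ) :=
    hg.mul_bdd hb' ((measurePreserving_fst_compProd μ κ).quasiMeasurePreserving.ae hC)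
  refine ⟨hi, ?_⟩
  rw [Measure.integral_compProd hi]
  simp only [integral_mul_const]

theorem integrable_kernel_integral {X Y : Type*} [MeasurableSpace X] [MeasurableSpace Y]
    {μ : Measure X} [SFinite μ] {κ : Kernel X Y} [IsMarkovKernel κ] {g : Y → ℝ}
    (hg : Integrable (fun w : X × Y => g w.2) (μ.compProd κ)) :
    Integrable (fun x => ∫ y, g y ∂(κ x)) μ :=
  MeasureTheory.Integrable.integral_compProd (κ := Kernel.const Unit μ)
    (η := Kernel.prodMkLeft Unit κ) (a := ()) hg

theorem integral_compProd_fst {X Y : Type*} [MeasurableSpace X] [MeasurableSpace Y] {μ : Measure X}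
    [SFinite μ] {κ : Kernel X Y} [IsMarkovKernel κ] {b : X → ℝ} (hb : Integrable b μ) :
    Integrable (fun w : X × Y => b w.1) (μ.compProd κ) ∧
      ∫ w, b w.1 ∂(μ.compProd κ) = ∫ x, b x ∂μ := by
  have h2 := measurePreserving_fst_compProd μ κ
  refine ⟨h2.integrable_comp_of_integrable hb, ?_⟩
  have h3 := integral_map (f := b) h2.measurable.aemeasurable (by rw [h2.map_eq]; exact hb.1)
  rw [h2.map_eq] at h3
  exact h3.symm

/-- The averaged weak formulation, tested with `ξ Γᵢ(v)`, subtracted from the entropy inequality. -/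
theorem integral_entropyBalance_nonneg {T p : ℝ} (hT : 0 < T) {A : State n → State n}
    {f : State n → ℝ} {Γ : State n → State n}
    {F : Fin d → State n → State n} {q : Fin d → State n → ℝ}
    (hC : ConservedForm f Γ F q) (hA : Continuous A) (hf0 : ∀ u, 0 ≤ f u)
    {u : Torus d × ℝ → State n}
    {ν : Kernel (Torus d × ℝ) (State n)} {γ : Measure (Torus d × ℝ)}
    {ν₀ : Kernel (Torus d) (State n)}
    (hmv : IsDissipativeMVSolution T p A (fun α l => F α (A l)) (fun l => f (A l)) u ν γ ν₀ 0)
    {v : Torus d × ℝ → State n} {K : ℝ≥0} (hv : LipschitzWith K (v ∘ proj d)) {R : ℝ}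
    (hR : ∀ z, ‖v z‖ ≤ R) {u₀ : Torus d → State n}
    (hν₀ : ∀ᵐ x : Torus d, ν₀ x = Measure.dirac (u₀ x)) (hu₀ : ∀ x, A (u₀ x) = v (x, 0))
    {ξ : ℝ → ℝ} (hξ : IsTimeTest T ξ) (hξ' : ∀ t, deriv ξ t ≤ 0) :
    Integrable (fun w => entropyBalance T f Γ F q v ξ w.1 (A w.2)) ((cylVol d T).compProd ν) ∧
      0 ≤ ∫ w, entropyBalance T f Γ F q v ξ w.1 (A w.2) ∂((cylVol d T).compProd ν) := by
  have := hmv.markov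
  have := hmv.markov_zero
  obtain ⟨hξc, ⟨τ, hτ, hξ0⟩, hξn⟩ := id hξ
  have hvc : Continuous v := continuous_of_comp_proj hv.continuous
  set P := (cylVol d T).compProd ν with hP
  have hηi : Integrable (fun w : (Torus d × ℝ) × State n => f (A w.2)) P := hmv.integrable_eta
  have hgrow : ∀ {g : State n → State n}, Continuous g →
      Tendsto (fun y => ‖g y‖ / f y) (cocompact (State n)) (𝓝 0) → ∀ i,
      Integrable (fun w : (Torus d × ℝ) × State n => g (A w.2) i) P := by
    intro g hg hlim i
    obtain ⟨c, hc⟩ := exists_growth_bound hf0 hC.tendsto_atTop hg hlim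
    refine ((hηi.add (integrable_const 1)).const_mul c).mono' ?_ (ae_of_all _ fun w =>
      (PiLp.norm_apply_le _ i).trans (hc _))
    have h1 : Continuous fun l : State n => g (A l) i :=
      (EuclideanSpace.proj (𝕜 := ℝ) i).continuous.comp (hg.comp hA)
    exact (h1.measurable.comp measurable_snd).aestronglyMeasurable
  have hAi := hgrow (g := id) continuous_id hC.id_little
  have hFi := fun α => hgrow (hC.contDiff_flux α).continuous (hC.flux_little α)
  have htest : ∀ {g : ℝ × State n → ℝ}, ContDiff ℝ 1 g → (∃ L : ℝ≥0,
      LipschitzWith L (evalAlong T v g ∘ proj d)) := fun hg =>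
    exists_lipschitzWith_evalAlong hT.le hv hR hg
  have hmeas : ∀ {g : ℝ × State n → ℝ}, ContDiff ℝ 1 g → ∀ w : Cover d,
      AEStronglyMeasurable (dirDeriv w (evalAlong T v g)) (cylVol d T) ∧
      ∃ C, ∀ z, ‖dirDeriv w (evalAlong T v g) z‖ ≤ C := by
    intro g hg w
    obtain ⟨L, hL⟩ := htest hg
    exact ⟨(measurable_dirDeriv hL.continuous).aestronglyMeasurable, _, norm_dirDeriv_le hL⟩
  have hclamp0 : max 0 (min 0 T) = 0 := by rw [min_eq_left hT.le, max_self]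
  have hclampT : max 0 (min T T) = T := by rw [min_self, max_eq_right hT.le]
  have hη : Integrable (fun w : (Torus d × ℝ) × State n => deriv ξ w.1.2 * f (A w.2)) P ∧
      ∫ w, deriv ξ w.1.2 * f (A w.2) ∂P =
        ∫ z, deriv ξ z.2 * (∫ l, f (A l) ∂(ν z)) ∂(cylVol d T) := by
    have hdc : Continuous (deriv ξ) := hξc.continuous_deriv le_rfl
    obtain ⟨C, hCb⟩ := (isCompact_Icc (a := 0) (b := T)).exists_bound_of_continuousOn
      hdc.continuousOn
    have hb : ∀ᵐ z ∂(cylVol d T), ‖deriv ξ z.2‖ ≤ C := by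
      filter_upwards [ae_cylVol_mem_Ioo T] with z hz
      exact hCb _ ⟨hz.1.le, hz.2.le⟩
    have := integral_compProd_mul (g := fun l => f (A l)) hηi
      (b := fun z : Torus d × ℝ => deriv ξ z.2)
      (hdc.comp continuous_snd).aestronglyMeasurable hb
    simpa only [mul_comm] using this
  have hE : 0 ≤ (∫ w, deriv ξ w.1.2 * f (A w.2) ∂P) + ∫ x, ξ 0 * f (v (x, 0)) := by
    have h1 := hmv.entropy_ineq ξ hξ
    rw [hη.2]
    -- The concentration measure enters with a favourable sign and is discarded.
    have h2 : ∫ z in cyl d T, deriv ξ z.2 ∂γ ≤ 0 :=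
      setIntegral_nonpos (measurableSet_cyl T) fun z _ => hξ' z.2
    have h3 : ∫ x, ξ 0 * (∫ l, f (A l) ∂(ν₀ x)) = ∫ x, ξ 0 * f (v (x, 0)) := by
      refine integral_congr_ae ?_
      filter_upwards [hν₀] with x hx
      rw [hx, integral_dirac, hu₀]
    rw [h3, integral_zero_measure] at h1
    linarith
  have hW : ∀ i,
      Integrable (fun w : (Torus d × ℝ) × State n =>
        A w.2 i * dt (evalAlong T v (gradTest Γ ξ i)) w.1 +
        ∑ α, F α (A w.2) i * dx α (evalAlong T v (gradTest Γ ξ i)) w.1) P ∧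
      (∫ w, (A w.2 i * dt (evalAlong T v (gradTest Γ ξ i)) w.1 +
        ∑ α, F α (A w.2) i * dx α (evalAlong T v (gradTest Γ ξ i)) w.1) ∂P) =
        -∫ x, ξ 0 * (v (x, 0) i * Γ (v (x, 0)) i) := by
    intro i
    have hg := hC.contDiff_gradTest hξc i
    obtain ⟨L, hL⟩ := htest hg
    have hA' := integrable_kernel_integral (g := fun l => A l i) (hAi i)
    have hF' := fun α => integrable_kernel_integral (g := fun l => F α (A l) i) (hFi α i)
    have hc : ∀ᵐ x : Torus d, ∫ l, A l i ∂(ν₀ x) = v (x, 0) i := by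
      filter_upwards [hν₀] with x hx
      rw [hx, integral_dirac, hu₀]
    have hvi : Continuous fun x : Torus d => v (x, 0) i :=
      (EuclideanSpace.proj (𝕜 := ℝ) i).continuous.comp (by fun_prop)
    have hci : Integrable fun x : Torus d => ∫ l, A l i ∂(ν₀ x) := by
      refine Integrable.congr ?_ (hc.mono fun x hx => hx.symm)
      simpa using hvi.continuousOn.integrableOn_compact (μ := volume) isCompact_univ
    have hwf := weak_form_of_lipschitz hA' hF' hci (hmv.weak_form i) hL (max_lt hτ hT)
      fun x t ht => by
        have h1 : τ ≤ max 0 (min t T) := by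
          refine le_max_of_le_right (le_min ((le_max_left _ _).trans ht) hτ.le)
        simp [evalAlong, gradTest, hξ0 _ h1]
    have hphi : ∫ x, (∫ l, A l i ∂(ν₀ x)) * evalAlong T v (gradTest Γ ξ i) (x, 0) =
        ∫ x, ξ 0 * (v (x, 0) i * Γ (v (x, 0)) i) := by
      refine integral_congr_ae ?_
      filter_upwards [hc] with x hx
      simp only [hx, evalAlong, gradTest, hclamp0]
      ring
    rw [hphi] at hwf
    obtain ⟨m1, C1, b1⟩ := hmeas hg (timeDir d)
    have k1 := integral_compProd_mul (g := fun l => A l i) (hAi i) m1 (ae_of_all _ b1)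
    have k2 : ∀ α, Integrable (fun w : (Torus d × ℝ) × State n =>
          F α (A w.2) i * dx α (evalAlong T v (gradTest Γ ξ i)) w.1) P ∧
        ∫ w, F α (A w.2) i * dx α (evalAlong T v (gradTest Γ ξ i)) w.1 ∂P =
          ∫ z, (∫ l, F α (A l) i ∂(ν z)) * dx α (evalAlong T v (gradTest Γ ξ i)) z
            ∂(cylVol d T) := by
      intro α
      obtain ⟨m2, C2, b2⟩ := hmeas hg (spaceDir α)
      simpa only [dx_eq] using
        integral_compProd_mul (g := fun l => F α (A l) i) (hFi α i) m2 (ae_of_all _ b2)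
    simp only [← dt_eq] at k1
    have k3 : ∀ α, Integrable (fun z => (∫ l, F α (A l) i ∂(ν z)) *
        dx α (evalAlong T v (gradTest Γ ξ i)) z) (cylVol d T) := by
      intro α
      obtain ⟨m2, C2, b2⟩ := hmeas hg (spaceDir α)
      simp only [dx_eq]
      exact (hF' α).mul_bdd m2 (ae_of_all _ b2)
    have k4 := integrable_finsetSum Finset.univ fun α (_ : α ∈ Finset.univ) => (k2 α).1
    refine ⟨k1.1.add k4, ?_⟩
    rw [integral_add k1.1 k4, k1.2, integral_finsetSum _ fun α _ => (k2 α).1,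
      Finset.sum_congr rfl fun α _ => (k2 α).2, ← integral_finsetSum _ fun α _ => k3 α]
    linarith
  have hκ : Integrable (fun w : (Torus d × ℝ) × State n =>
        dt (evalAlong T v (legendreTest f Γ ξ)) w.1) P ∧
      ∫ w, dt (evalAlong T v (legendreTest f Γ ξ)) w.1 ∂P =
        -∫ x, ξ 0 * (f (v (x, 0)) - inner ℝ (v (x, 0)) (Γ (v (x, 0)))) := by
    obtain ⟨L, hL⟩ := htest (hC.contDiff_legendreTest hξc)
    have h1 := integral_compProd_fst (κ := ν) (integrable_dirDeriv (T := T) (v := timeDir d) hL)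
    simp only [← dt_eq] at h1
    refine ⟨h1.1, ?_⟩
    rw [h1.2, integral_dt_of_lipschitz hT.le hL]
    simp only [evalAlong, legendreTest, hclamp0, hclampT, hξ0 T hτ.le]
    simp
  have hq : ∀ α, Integrable (fun w : (Torus d × ℝ) × State n =>
        dx α (evalAlong T v (legendreFluxTest Γ (F α) (q α) ξ)) w.1) P ∧
      ∫ w, dx α (evalAlong T v (legendreFluxTest Γ (F α) (q α) ξ)) w.1 ∂P = 0 := by
    intro α
    obtain ⟨L, hL⟩ := htest (hC.contDiff_legendreFluxTest hξc α)
    have h1 := integral_compProd_fst (κ := ν) (integrable_dirDeriv (T := T) (v := spaceDir α) hL)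
    simp only [← dx_eq] at h1
    exact ⟨h1.1, h1.2.trans (integral_dx_of_lipschitz α hL)⟩
  have hWs := integrable_finsetSum Finset.univ fun i (_ : i ∈ Finset.univ) => (hW i).1
  have hqs := integrable_finsetSum Finset.univ fun α (_ : α ∈ Finset.univ) => (hq α).1
  have hint : Integrable (fun w => entropyBalance T f Γ F q v ξ w.1 (A w.2)) P :=
    ((hη.1.sub hWs).sub hκ.1).sub hqs
  refine ⟨hint, ?_⟩
  have hcont : ∀ {k : State n → ℝ}, Continuous k → Integrable fun x : Torus d => ξ 0 * k (v (x, 0)) :=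
    fun {k} hk => by
      have : Continuous fun x : Torus d => ξ 0 * k (v (x, 0)) := by fun_prop
      simpa using this.continuousOn.integrableOn_compact (μ := volume) isCompact_univ
  have hΓc := hC.contDiff_grad.continuous
  -- The initial terms `ξ(0) v · Γ(v)` from the weak form and from the Legendre transform cancel,
  -- leaving `ξ(0) f(v)`; the result is the nonnegative quantity in `hE`.
  have e1 : ∫ w, entropyBalance T f Γ F q v ξ w.1 (A w.2) ∂P =
      (∫ w, deriv ξ w.1.2 * f (A w.2) ∂P) + (∑ i, ∫ x, ξ 0 * (v (x, 0) i * Γ (v (x, 0)) i)) +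
        ∫ x, ξ 0 * (f (v (x, 0)) - inner ℝ (v (x, 0)) (Γ (v (x, 0)))) := by
    have i1 := integral_sub ((hη.1.sub hWs).sub hκ.1) hqs
    have i2 := integral_sub (hη.1.sub hWs) hκ.1
    have i3 := integral_sub hη.1 hWs
    simp only [Pi.sub_apply] at i1 i2
    simp only [entropyBalance]
    rw [i1, i2, i3, integral_finsetSum _ fun i _ => (hW i).1,
      integral_finsetSum _ fun α _ => (hq α).1, hκ.2, Finset.sum_congr rfl fun i _ => (hW i).2,
      Finset.sum_congr rfl fun α _ => (hq α).2, Finset.sum_neg_distrib]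
    simp
  have e2 : (∑ i, ∫ x, ξ 0 * (v (x, 0) i * Γ (v (x, 0)) i)) =
      ∫ x, ξ 0 * inner ℝ (v (x, 0)) (Γ (v (x, 0))) := by
    rw [← integral_finsetSum _ fun i _ => hcont (k := fun y => y i * Γ y i) (by fun_prop)]
    refine integral_congr_ae (ae_of_all _ fun x => ?_)
    simp [PiLp.inner_apply, Finset.mul_sum, mul_comm]
  have e3 : ∫ x, ξ 0 * (f (v (x, 0)) - inner ℝ (v (x, 0)) (Γ (v (x, 0)))) =
      (∫ x, ξ 0 * f (v (x, 0))) - ∫ x, ξ 0 * inner ℝ (v (x, 0)) (Γ (v (x, 0))) := by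
    rw [← integral_sub (hcont hC.contDiff_f.continuous)
      (hcont (k := fun y => inner ℝ y (Γ y)) (by fun_prop))]
    simp only [mul_sub]
  rw [e1, e2, e3]
  linarith

end Uniqueness

/-! ### Vanishing of the relative entropy. -/

section WeakStrong

variable {n d : ℕ}

theorem eq_dirac_of_ae_eq {Y : Type*} [MeasurableSpace Y] {μ : Measure Y}
    [IsProbabilityMeasure μ] {a : Y} (h : ∀ᵐ y ∂μ, y = a) : μ = Measure.dirac a := by
  have h1 : μ.map id = μ.map fun _ => a := Measure.map_congr h
  rw [Measure.map_id, Measure.map_const, measure_univ, one_smul] at h1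
  exact h1

/-- Weak-strong uniqueness in conserved variables. -/
theorem ae_eq_of_dissipative {T p : ℝ} (hT : 0 < T) {A : State n → State n}
    {f : State n → ℝ} {Γ : State n → State n}
    {F : Fin d → State n → State n} {q : Fin d → State n → ℝ}
    (hC : ConservedForm f Γ F q) (hA : Continuous A) (hf0 : ∀ u, 0 ≤ f u)
    {u : Torus d × ℝ → State n}
    {ν : Kernel (Torus d × ℝ) (State n)} {γ : Measure (Torus d × ℝ)}
    {ν₀ : Kernel (Torus d) (State n)}
    (hmv : IsDissipativeMVSolution T p A (fun α l => F α (A l)) (fun l => f (A l)) u ν γ ν₀ 0)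
    {v : Torus d × ℝ → State n} {K : ℝ≥0} (hv : LipschitzWith K (v ∘ proj d)) {R : ℝ}
    (hR : ∀ z, ‖v z‖ ≤ R) {u₀ : Torus d → State n}
    (hν₀ : ∀ᵐ x : Torus d, ν₀ x = Measure.dirac (u₀ x)) (hu₀ : ∀ x, A (u₀ x) = v (x, 0))
    (hstrong : ∀ᵐ z ∂(cylVol d T), DifferentiableAt ℝ (v ∘ proj d) (sect z) ∧
      fderiv ℝ (v ∘ proj d) (sect z) (timeDir d) +
        ∑ α, fderiv ℝ (F α) (v z) (fderiv ℝ (v ∘ proj d) (sect z) (spaceDir α)) = 0) :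
    ∀ᵐ w ∂((cylVol d T).compProd ν), A w.2 = v w.1 := by
  have := hmv.markov
  -- Coordinate directions have norm at most one in the cover, so the Lipschitz constant bounds
  -- every `∂_α v`.
  obtain ⟨C, hCb⟩ := hC.exists_source_bound R (K * 1)
  have hvx : ∀ z (α : Fin d), ‖fderiv ℝ (v ∘ proj d) (sect z) (spaceDir α)‖ ≤ K * 1 := by
    intro z α
    refine (ContinuousLinearMap.le_opNorm _ _).trans
      (mul_le_mul (norm_fderiv_le_of_lipschitz ℝ hv) ?_ (norm_nonneg _) K.2)
    simp [spaceDir, Prod.norm_def, Pi.norm_single]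
  have hfst := (measurePreserving_fst_compProd (cylVol d T) ν).quasiMeasurePreserving
  have key : ∀ τ < T, ∀ᵐ w ∂((cylVol d T).compProd ν), w.1.2 < τ → A w.2 = v w.1 := by
    intro τ hτ
    -- Of the decay rate `max C 0 + 1`, the first part absorbs the source and the `1` leaves `-ξ`
    -- times the relative entropy.
    obtain ⟨ξ, hξ, hξ0, hξd, hξpos, -⟩ := exists_decaying_timeTest (K := max C 0 + 1) hτ
    have hξd0 : ∀ t, deriv ξ t ≤ 0 := fun t => (hξd t).trans (by
      have := mul_nonneg (by positivity : 0 ≤ max C 0 + 1) (hξ0 t)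
      linarith)
    obtain ⟨hi, hnn⟩ := integral_entropyBalance_nonneg hT hC hA hf0 hmv hv hR hν₀ hu₀ hξ hξd0
    have hle : ∀ᵐ w ∂((cylVol d T).compProd ν),
        entropyBalance T f Γ F q v ξ w.1 (A w.2) ≤
          -(ξ w.1.2 * relEntropy f Γ (A w.2) (v w.1)) := by
      filter_upwards [hfst.ae (hstrong.and (ae_cylVol_mem_Ioo T))] with w hw
      obtain ⟨⟨h1, h2⟩, h3⟩ := hw
      rw [hC.entropyBalance_eq hξ.1 h3 h1]
      have h4 := mul_le_mul_of_nonneg_left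
        (hCb (v w.1) _ _ (hR _) (hvx w.1) h2 (A w.2)) (hξ0 w.1.2)
      have h5 := hC.relEntropy_nonneg (A w.2) (v w.1)
      have h6 := mul_le_mul_of_nonneg_right (hξd w.1.2) h5
      have h7 := mul_le_mul_of_nonneg_right (le_max_left C 0) (mul_nonneg (hξ0 w.1.2) h5)
      linarith
    have hle0 : ∀ᵐ w ∂((cylVol d T).compProd ν),
        0 ≤ -entropyBalance T f Γ F q v ξ w.1 (A w.2) := by
      filter_upwards [hle] with w hw
      have := mul_nonneg (hξ0 w.1.2) (hC.relEntropy_nonneg (A w.2) (v w.1))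
      linarith
    -- The integrand is almost everywhere nonpositive and its integral nonnegative, so it vanishes
    -- almost everywhere.
    have hzero := (integral_eq_zero_iff_of_nonneg_ae hle0 hi.neg).1
      (le_antisymm (by rw [integral_neg]; linarith) (integral_nonneg_of_ae hle0))
    filter_upwards [hle, hzero] with w h1 h2 h3
    by_contra hne
    have h4 := mul_pos (hξpos _ h3) (hC.relEntropy_pos hne)
    have h5 : -entropyBalance T f Γ F q v ξ w.1 (A w.2) = 0 := h2
    linarith
  have hall : ∀ᵐ w ∂((cylVol d T).compProd ν), ∀ k : ℕ,
      w.1.2 < T - 1 / ((k : ℝ) + 1) → A w.2 = v w.1 :=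
    ae_all_iff.2 fun k => key _ (sub_lt_self _ Nat.one_div_pos_of_nat)
  filter_upwards [hall, hfst.ae (ae_cylVol_mem_Ioo T)] with w h1 h2
  obtain ⟨k, hk⟩ := exists_nat_one_div_lt (sub_pos.2 h2.2)
  exact h1 k (by linarith)

/-- Weak-strong uniqueness for a strong solution that is Lipschitz on all of `𝕋ᵈ × ℝ`; the
initial data and the equation are required only where they make sense. -/
theorem ae_eq_dirac_of_lipschitz {T p : ℝ} (hT : 0 < T) {A : State n → State n}
    {F : Fin d → State n → State n} {η : State n → ℝ} {q : Fin d → State n → ℝ}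
    {G : State n → State n} {e : State n ≃ₜ State n} (he : ⇑e = A)
    (hC : ConservedForm (η ∘ e.symm) (G ∘ e.symm) (fun α => F α ∘ e.symm) (fun α => q α ∘ e.symm))
    (hA : ContDiff ℝ 1 A) (hη : ∀ u, 0 ≤ η u) {u : Torus d × ℝ → State n}
    {ν : Kernel (Torus d × ℝ) (State n)} {γ : Measure (Torus d × ℝ)}
    {ν₀ : Kernel (Torus d) (State n)} (hmv : IsDissipativeMVSolution T p A F η u ν γ ν₀ 0)
    {U : Torus d × ℝ → State n} {K : ℝ≥0} (hU : LipschitzWith K (U ∘ proj d)) {R₀ : ℝ}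
    (hR₀ : ∀ z, ‖U z‖ ≤ R₀) (hstrong : IsStrongSolution T A F U)
    (hν₀ : ∀ᵐ x : Torus d, ν₀ x = Measure.dirac (U (x, 0))) :
    ∀ᵐ z ∂(cylVol d T), ν z = Measure.dirac (U z) := by
  have hes : ∀ l, e.symm (A l) = l := fun l => by simp [← he]
  obtain ⟨L, hL⟩ : ∃ L : ℝ≥0, LipschitzWith L ((fun z => A (U z)) ∘ proj d) :=
    exists_lipschitzWith_comp hA hU fun y => hR₀ _
  obtain ⟨R, hR⟩ : ∃ R, ∀ z, ‖A (U z)‖ ≤ R := by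
    obtain ⟨R, h⟩ := (isCompact_closedBall (0 : State n) R₀).exists_bound_of_continuousOn
      hA.continuous.continuousOn
    exact ⟨R, fun z => h _ (by simpa using hR₀ z)⟩
  obtain ⟨a, b, ha, hb, hab⟩ := hstrong
  have hb' : ∀ α, HasWeakDx T α (fun z => (F α ∘ e.symm) (A (U z))) (b α) := fun α => by
    simpa only [Function.comp_apply, hes] using hb α
  have hs := strong_equation hT (v := fun z => A (U z)) (F := fun α => F α ∘ e.symm) hL hR
    (fun α => (hC.contDiff_flux α).of_le one_le_two) ha hb' hab
  have hmv' : IsDissipativeMVSolution T p A (fun α l => (F α ∘ e.symm) (A l))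
      (fun l => (η ∘ e.symm) (A l)) u ν γ ν₀ 0 := by
    simpa only [Function.comp_apply, hes] using hmv
  have hν := hmv.markov
  have hmain := ae_eq_of_dissipative (v := fun z => A (U z)) (u₀ := fun x => U (x, 0)) hT hC
    hA.continuous (fun y => hη _) hmv' hL hR hν₀ (fun x => rfl) hs
  -- Disintegration gives `A l = A (U z)` for `ν z`-almost every `l`, for almost every `z`;
  -- inverting `A` shows that `ν z` is concentrated at one point.
  filter_upwards [Measure.ae_ae_of_ae_compProd hmain] with z hz
  refine eq_dirac_of_ae_eq (hz.mono fun l hl => ?_)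
  rw [← hes l, hl, hes]

/-- A continuous `W^{1,∞}` strong solution agrees on `𝕋ᵈ × [0,T]` with a bounded strong solution
that is Lipschitz on all of `𝕋ᵈ × ℝ`. -/
theorem MemW1Inf.exists_lipschitz_extension {T : ℝ} (hT : 0 < T) {A : State n → State n}
    {F : Fin d → State n → State n} {f : Torus d × ℝ → State n} (hf : MemW1Inf T f)
    (hs : IsStrongSolution T A F f) :
    ∃ (U : Torus d × ℝ → State n) (K : ℝ≥0) (R : ℝ), LipschitzWith K (U ∘ proj d) ∧
      (∀ z, ‖U z‖ ≤ R) ∧ IsStrongSolution T A F U ∧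
      ∀ z : Torus d × ℝ, z.2 ∈ Set.Icc 0 T → U z = f z := by
  obtain ⟨K, hK⟩ := hf.exists_lipschitzWith hT
  obtain ⟨R, hR⟩ := (isCompact_univ.prod (isCompact_Icc (a := (0 : ℝ)) (b := T))
    ).exists_bound_of_continuousOn hf.continuousOn
  have hU : ∀ z : Torus d × ℝ, z.2 ∈ Set.Icc 0 T → f (clampTime T z) = f z := fun z hz => by
    rw [clampTime_of_mem hz]
  have hcyl : ∀ z ∈ cyl d T, f z = f (clampTime T z) := fun z hz =>
    (hU z ⟨hz.2.1, hz.2.2.le⟩).symm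
  refine ⟨fun z => f (clampTime T z), K, R, hK, fun z => hR _ (clampTime_mem hT.le z), ?_, hU⟩
  obtain ⟨a, b, ha, hb, hab⟩ := hs
  exact ⟨a, b, ha.congr_left fun z hz => congrArg A (hcyl z hz),
    fun α => (hb α).congr_left fun z hz => congrArg (F α) (hcyl z hz), hab⟩

end WeakStrong

end ConsLaw

/-! ### Conclusion for the original strong solution. -/

theorem mainTheorem2 {n d : ℕ} (T : ℝ) (hT : 0 < T)
    (A : ConsLaw.State n → ConsLaw.State n)
    (F : Fin d → ConsLaw.State n → ConsLaw.State n)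
    (η : ConsLaw.State n → ℝ) (q : Fin d → ConsLaw.State n → ℝ)
    (G : ConsLaw.State n → ConsLaw.State n)
    (hF : ∀ α, ContDiff ℝ 2 (F α))
    (hH1 : ConsLaw.HypH1 A) (hH2 : ConsLaw.HypH2 A F η q G) (hH3 : ConsLaw.HypH3 A η G)
    (p : ℝ) (hp : 1 < p) (hA1 : ConsLaw.HypA1 η p) (hA2 : ConsLaw.HypA2 F η)
    (hA3 : ConsLaw.HypA3 A η) (hA4 : ConsLaw.HypA4 A η) (hη : ∀ u, 0 ≤ η u)
    (u : ConsLaw.Torus d × ℝ → ConsLaw.State n)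
    (ν : Kernel (ConsLaw.Torus d × ℝ) (ConsLaw.State n))
    (γ : Measure (ConsLaw.Torus d × ℝ))
    (ν₀ : Kernel (ConsLaw.Torus d) (ConsLaw.State n)) (γ₀ : Measure (ConsLaw.Torus d))
    (hmv : ConsLaw.IsDissipativeMVSolution T p A F η u ν γ ν₀ γ₀)
    (ubar : ConsLaw.Torus d × ℝ → ConsLaw.State n)
    (hubar : ConsLaw.MemW1Inf T ubar) (hstrong : ConsLaw.IsStrongSolution T A F ubar)
    (hγ₀ : γ₀ = 0) (hν₀ : ∀ᵐ x : ConsLaw.Torus d, ν₀ x = Measure.dirac (ubar (x, 0))) :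
    (∀ᵐ z ∂(ConsLaw.cylVol d T), ν z = Measure.dirac (ubar z)) ∧
    (∀ᵐ z ∂(ConsLaw.cylVol d T), u z = ubar z) := by
  subst hγ₀
  obtain ⟨e, he, hC⟩ := ConsLaw.exists_conservedForm hF hH1 hH2 hH3 hp hA1 hA2 hA3 hA4
  -- The extension agrees with `ubar` on the closed time interval, in particular at `t = 0`, so the
  -- initial Dirac condition carries over.
  obtain ⟨U, K, R, hK, hR, hs, hU⟩ := hubar.exists_lipschitz_extension hT hstrong
  have hdirac : ∀ᵐ z ∂(ConsLaw.cylVol d T), ν z = Measure.dirac (ubar z) := by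
    have hmem : ∀ᵐ z ∂(ConsLaw.cylVol d T), z ∈ ConsLaw.cyl d T :=
      ae_restrict_mem (ConsLaw.measurableSet_cyl T)
    filter_upwards [ConsLaw.ae_eq_dirac_of_lipschitz hT he hC (hH1.contDiff.of_le one_le_two) hη
      hmv hK hR hs (hν₀.mono fun x hx => by rw [hx, hU (x, 0) ⟨le_rfl, hT.le⟩]), hmem] with z hz hzc
    rw [hz, hU z ⟨hzc.2.1, hzc.2.2.le⟩]
  refine ⟨hdirac, ?_⟩
  -- The barycentre of a Dirac mass is its base point.
  filter_upwards [hdirac, hmv.barycenter] with z h1 h2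
  rw [h2, h1, integral_dirac]
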